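/- Let $n,m,d,b\ge 1$ be integers. For a signal $f\in\mathbb R^d$, machines $j=1,\dots,m$ observe independent vectors $X^j=f+\sqrt{m/n}\,Z^j$, where $Z^1,\dots,Z^m$ are independent standard normal vectors in $\mathbb R^d$. Write $X=(X^1,\dots,X^m)$. A private-coin $b$-bit distributed testing protocol consists of finite transcript spaces $\mathcal Y^1,\dots,\mathcal Y^m$ with $|\mathcal Y^j|\le 2^b$, Markov kernels $K^j(\cdot\mid X^j)$ on $\mathcal Y^j$, according to which, given $X$, the transcripts $Y^1,\dots,Y^m$ are drawn independently, and a map $T:\mathcal Y^1\times\dots\times\mathcal Y^m\to\{0,1\}$. In a public-coin $b$-bit protocol there is moreover a random variable $U$, with values in a probability space and independent of $X$, and given $(X,U)$ the transcripts are drawn independently from kernels $K^j(\cdot\mid X^j,U)$. Let $\mathcal T_{priv}(b)$ and $\mathcal T_{pub}(b)$ be the classes of these protocols, let $\mathbb P_f$ be the resulting joint law under the signal $f$, and write $Y=(Y^1,\dots,Y^m)$. For $\rho>0$ let $H_\rho=\{f\in\mathbb R^d:\|f\|_2\ge\rho\}$ and define the testing risk $$\mathcal R(H_\rho,T)=\mathbb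 P_0(T(Y)=1)+\sup_{f\in H_\rho}\mathbb P_f(T(Y)=0).$$ Theorem. For each $\alpha\in(0,1)$ there exists a constant $C_\alpha>0$, depending only on $\alpha$, such that for all integers $n,m,d,b\ge 1$ and all $\rho>0$ the following hold. (1) If $\rho^2\ge C_\alpha\frac{\sqrt d}{n}\Big(\sqrt{\frac{d}{b\wedge d}}\wedge\sqrt m\Big)$, there exists $T\in\mathcal T_{pub}(b)$ with $\mathcal R(H_\rho,T)\le\alpha$. (2) If $\rho^2\ge C_\alpha\frac{\sqrt d}{n}\Big(\frac{d}{b\wedge d}\wedge\sqrt m\Big)$, there exists $T\in\mathcal T_{priv}(b)$ with $\mathcal R(H_\rho,T)\le\alpha$. -/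

import Mathlib

open MeasureTheory ProbabilityTheory

open scoped ENNReal

noncomputable section

namespace DistributedTesting

/-- The sample space of one machine: `ℝ^d` with the Euclidean norm. -/
abbrev Obs (d : ℕ) : Type := EuclideanSpace ℝ (Fin d)

/-- The law of one local observation `X^j = f + √(m/n) Z^j`, with `Z^j` standard normal in `ℝ^d`. -/
def localLaw (n m d : ℕ) (f : Obs d) : Measure (Obs d) :=
  (stdGaussian (Obs d)).map (fun z => f + Real.sqrt ((m : ℝ) / (n : ℝ)) • z)

instance isProbabilityMeasure_localLaw (n m d : ℕ) (f : Obs d) :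
    IsProbabilityMeasure (localLaw n m d f) :=
  Measure.isProbabilityMeasure_map (by fun_prop)

/-- The law `P_f` of the whole data `X = (X^1, …, X^m)`, the `X^j` being independent. -/
def dataLaw (n m d : ℕ) (f : Obs d) : Measure (Fin m → Obs d) :=
  Measure.pi (fun _ => localLaw n m d f)

instance isProbabilityMeasure_dataLaw (n m d : ℕ) (f : Obs d) :
    IsProbabilityMeasure (dataLaw n m d f) := by
  unfold dataLaw; infer_instance

/-- The product `⨂_j κ^j` of finitely many Markov kernels with the same source: given the source
point, the coordinates are drawn independently, the `j`-th one from `κ^j`. -/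
def productKernel {ι A : Type*} [Fintype ι] [MeasurableSpace A] {Y : ι → Type*}
    [∀ j, MeasurableSpace (Y j)] (κ : ∀ j, Kernel A (Y j)) [∀ j, IsMarkovKernel (κ j)] :
    Kernel A (∀ j, Y j) where
  toFun a := Measure.pi (fun j => κ j a)
  measurable' := by
    refine Measurable.measure_of_isPiSystem_of_isProbabilityMeasure generateFrom_pi.symm
      isPiSystem_pi ?_
    rintro _ ⟨s, hs, rfl⟩
    simp only [Measure.pi_pi]
    exact Finset.measurable_prod _ fun j _ => (κ j).measurable_coe (hs j (Set.mem_univ j))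

instance isMarkovKernel_productKernel {ι A : Type*} [Fintype ι] [MeasurableSpace A]
    {Y : ι → Type*} [∀ j, MeasurableSpace (Y j)] (κ : ∀ j, Kernel A (Y j))
    [∀ j, IsMarkovKernel (κ j)] : IsMarkovKernel (productKernel κ) :=
  ⟨fun a => by
    change IsProbabilityMeasure (Measure.pi (fun j => κ j a))
    infer_instance⟩

/-- A private coin distributed testing protocol for `m` machines observing vectors in `ℝ^d`, with a
communication budget of `b` bits per machine: transcript spaces `Y^j` with at most `2^b` elements
(every subset being measurable), Markov kernels `K^j` giving the law of the transcript `Y^j` given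
the local observation `X^j`, and the central test `T`. -/
structure PrivateCoinProtocol (m d b : ℕ) where
  Y : Fin m → Type
  [fintypeY : ∀ j, Fintype (Y j)]
  [measurableSpaceY : ∀ j, MeasurableSpace (Y j)]
  [discreteY : ∀ j, DiscreteMeasurableSpace (Y j)]
  card_le : ∀ j, Fintype.card (Y j) ≤ 2 ^ b
  K : ∀ j, Kernel (Obs d) (Y j)
  [markovK : ∀ j, IsMarkovKernel (K j)]
  T : (∀ j, Y j) → Fin 2

/-- A public coin distributed testing protocol: as in the private coin case, but there is moreover
a shared random variable `U`, with law `PU` on a measurable space, independent of the data, and the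
kernel `K^j` gives the law of the transcript `Y^j` given `(X^j, U)`. -/
structure PublicCoinProtocol (m d b : ℕ) where
  Y : Fin m → Type
  [fintypeY : ∀ j, Fintype (Y j)]
  [measurableSpaceY : ∀ j, MeasurableSpace (Y j)]
  [discreteY : ∀ j, DiscreteMeasurableSpace (Y j)]
  card_le : ∀ j, Fintype.card (Y j) ≤ 2 ^ b
  U : Type
  [measurableSpaceU : MeasurableSpace U]
  PU : Measure U
  [probPU : IsProbabilityMeasure PU]
  K : ∀ j, Kernel (Obs d × U) (Y j)
  [markovK : ∀ j, IsMarkovKernel (K j)]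
  T : (∀ j, Y j) → Fin 2

attribute [instance] PrivateCoinProtocol.fintypeY PrivateCoinProtocol.measurableSpaceY
  PrivateCoinProtocol.discreteY PrivateCoinProtocol.markovK

attribute [instance] PublicCoinProtocol.fintypeY PublicCoinProtocol.measurableSpaceY
  PublicCoinProtocol.discreteY PublicCoinProtocol.measurableSpaceU PublicCoinProtocol.probPU
  PublicCoinProtocol.markovK

/-- The alternative hypothesis `H_ρ = {f ∈ ℝ^d : ‖f‖₂ ≥ ρ}`. -/
def alternative (d : ℕ) (ρ : ℝ) : Set (Obs d) := {f | ρ ≤ ‖f‖}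

namespace PrivateCoinProtocol

variable {m d b : ℕ}

/-- The conditional law `⨂_j K^j(· | X^j)` of the transcripts given the data. -/
def transcriptKernel (P : PrivateCoinProtocol m d b) : Kernel (Fin m → Obs d) (∀ j, P.Y j) :=
  productKernel fun j => (P.K j).comap (fun x => x j) (measurable_pi_apply j)

/-- The joint law of `(X, Y)` under the signal `f`. -/
def jointLaw (P : PrivateCoinProtocol m d b) (n : ℕ) (f : Obs d) :
    Measure ((Fin m → Obs d) × (∀ j, P.Y j)) :=
  (dataLaw n m d f).compProd P.transcriptKernel

/-- The testing risk: `P_0(T(Y) = 1) + sup_{f ∈ H_ρ} P_f(T(Y) = 0)`. -/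
def risk (P : PrivateCoinProtocol m d b) (n : ℕ) (ρ : ℝ) : ℝ≥0∞ :=
  P.jointLaw n 0 {ω | P.T ω.2 = 1} + ⨆ f ∈ alternative d ρ, P.jointLaw n f {ω | P.T ω.2 = 0}

end PrivateCoinProtocol

namespace PublicCoinProtocol

variable {m d b : ℕ}

/-- The conditional law `⨂_j K^j(· | X^j, U)` of the transcripts given the data and `U`. -/
def transcriptKernel (P : PublicCoinProtocol m d b) :
    Kernel ((Fin m → Obs d) × P.U) (∀ j, P.Y j) :=
  productKernel fun j => (P.K j).comap (fun p => (p.1 j, p.2))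
    (((measurable_pi_apply j).comp measurable_fst).prodMk measurable_snd)

/-- The joint law of `((X, U), Y)` under the signal `f`; `U` is independent of `X`. -/
def jointLaw (P : PublicCoinProtocol m d b) (n : ℕ) (f : Obs d) :
    Measure (((Fin m → Obs d) × P.U) × (∀ j, P.Y j)) :=
  ((dataLaw n m d f).prod P.PU).compProd P.transcriptKernel

/-- The testing risk: `P_0(T(Y) = 1) + sup_{f ∈ H_ρ} P_f(T(Y) = 0)`. -/
def risk (P : PublicCoinProtocol m d b) (n : ℕ) (ρ : ℝ) : ℝ≥0∞ :=
  P.jointLaw n 0 {ω | P.T ω.2 = 1} + ⨆ f ∈ alternative d ρ, P.jointLaw n f {ω | P.T ω.2 = 0}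

end PublicCoinProtocol

end DistributedTesting

end

/-!
After multiplication by `√(n/m)` every machine observes `N(g, I)` with `g = √(n/m) f`, and
`‖f‖ ≥ ρ` becomes `‖g‖² ≥ n ρ² / m`. The thresholds of the theorem become, up to constants,
`√d / √m` for the branch `√m` of both minima, `√d (d / (b ∧ d)) / m` for private coins and
`√d √(d / (b ∧ d)) / m` for public coins. The predicate `Testable` says that a set of signals `g` is
detected by private-coin protocols; as disjoint groups of machines may run different tests, a finite
union of testable sets is testable (`Testable.union`).

*Large signals.* One machine alone, rejecting for large values of `∑ i, cosh (l * x i)`, detects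
`‖g‖² ≳ √d` and `∑ i, g i ^ 4 ≳ √d` (`exists_local_test`). It remains to treat signals for which
both sums are of order at most `√d`.

*The branch `√m`.* Each machine sends one bit, whose mean is a bounded statistic with mean `0` under
the null hypothesis and mean of the order `‖g‖² / √d` for `‖g‖² ≲ √d`; averaging `m` bits detects
means of order `1 / √m` (`exists_one_bit_test`). The statistic is `sin (l ‖x‖² - θ)` with `l` of
the order `1 / √d`. Its mean is the imaginary part of the rotated characteristic function of a
noncentral `χ²` variable, which is explicit (`exists_oscillating_statistic`).

*Private coins.* If `D`, of the order `d / (b ∧ d)`, machines share the coordinates among them, they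
send together the sign of one observation of each coordinate, so that `m` machines provide `m / D`
signs of each coordinate, with mean of the order `g i` when `|g i| ≤ 1`. The product of `2 q` sums
of `k` independent signs each, of order `m / D` for `k`, has mean of the order
`k ^ (2 q) * min (g i ^ 2) 1 ^ q` and, under the null hypothesis, variance `k ^ (2 q)`. Summing over
the coordinates detects `∑ i, min (g i ^ 2) 1 ^ q ≳ √d / k ^ q` (`exists_sign_test`). The case
`q = 1` is the usual estimate of the squared norm, but it misses signals concentrated on a few
coordinates, where signs saturate. The case `q = 2` repairs this: by the Cauchy–Schwarz inequality
`‖g‖² ≤ ∑ i, min (g i ^ 2) 1 + √((∑ i, min (g i ^ 2) 1 ^ 2) (∑ i, g i ^ 4))`, and an undetected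
signal has `∑ i, min (g i ^ 2) 1 ^ 2 ≲ √d / k ^ 2` and `∑ i, g i ^ 4 ≲ √d`, so that both terms are
of order at most `√d / k` (`sum_sq_le_of_truncated`, `exists_many_bits_test`).

*Public coins.* The coordinates are divided into `b ∧ d` blocks of about `d / (b ∧ d)` elements, and
the shared randomness draws a uniform direction in each of them. Projected on these orthonormal
directions, the observations are again Gaussian with unit noise, in dimension `b ∧ d`, and the
signal keeps a fraction of the order `(b ∧ d) / d` of its energy except with small probability
(`stdGaussian_sum_blockProjection_sq_lt_le`). Now each machine has a bit for every coordinate, so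
that the private test with `D = 1` needs only `‖g‖² (b ∧ d) / d ≳ √(b ∧ d) / m`, which is the
threshold `‖g‖² ≳ √d √(d / (b ∧ d)) / m`.
-/

noncomputable section

namespace DistributedTesting

/-! ### Product measures and product kernels -/

section ProductMeasures

variable {ι κ : Type*} [Fintype ι] [Fintype κ]

/-- Forgetting some of the coordinates of a product measure, and relabelling the remaining ones. -/
lemma pi_map_comp_injective {X : Type*} [MeasurableSpace X] (μ : ι → Measure X)
    [∀ i, IsProbabilityMeasure (μ i)] {f : κ → ι} (hf : Function.Injective f) :
    (Measure.pi μ).map (fun x k => x (f k)) = Measure.pi (fun k => μ (f k)) := by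
  rw [← Measure.infinitePi_eq_pi, ← Measure.infinitePi_eq_pi]
  exact Measure.map_infinitePi_infinitePi_of_inj hf

/-- A product of products is a product over pairs. -/
lemma pi_pi_map_uncurry {X : Type*} [MeasurableSpace X] (μ : ι → κ → Measure X)
    [∀ i k, IsProbabilityMeasure (μ i k)] :
    (Measure.pi fun i => Measure.pi (μ i)).map (fun x (p : ι × κ) => x p.1 p.2) =
      Measure.pi fun p : ι × κ => μ p.1 p.2 := by
  have := Measure.infinitePi_map_curry_symm (ι := ι) (κ := κ) μ
  simp only [Measure.infinitePi_eq_pi] at this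
  exact this

lemma pi_map_curry {X : Type*} [MeasurableSpace X] (μ : ι → κ → Measure X)
    [∀ i k, IsProbabilityMeasure (μ i k)] :
    (Measure.pi fun p : ι × κ => μ p.1 p.2).map (fun x i k => x (i, k)) =
      Measure.pi fun i => Measure.pi (μ i) := by
  have := Measure.infinitePi_map_curry (ι := ι) (κ := κ) μ
  simp only [Measure.infinitePi_eq_pi] at this
  exact this

/-- Passing independent inputs through separate channels gives independent outputs. -/
lemma productKernel_comp_pi {A : ι → Type*} {Y : ι → Type*} [∀ j, MeasurableSpace (A j)]
    [∀ j, MeasurableSpace (Y j)] (K : ∀ j, Kernel (A j) (Y j)) [∀ j, IsMarkovKernel (K j)]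
    (μ : ∀ j, Measure (A j)) [∀ j, IsProbabilityMeasure (μ j)] :
    (productKernel fun j => (K j).comap (fun x : ∀ j, A j => x j) (measurable_pi_apply j)) ∘ₘ
      Measure.pi μ = Measure.pi (fun j => K j ∘ₘ μ j) := by
  refine (Measure.pi_eq fun s hs => ?_).symm
  rw [Measure.bind_apply (MeasurableSet.univ_pi hs) (Kernel.aemeasurable _)]
  have h1 : ∀ x : ∀ j, A j, (productKernel fun j =>
      (K j).comap (fun x : ∀ j, A j => x j) (measurable_pi_apply j)) x (Set.univ.pi s) =
      ∏ j, K j (x j) (s j) := fun x => by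
    change Measure.pi (fun j => K j (x j)) _ = _
    rw [Measure.pi_pi]
  simp_rw [h1]
  rw [lintegral_prod_eq_prod_lintegral_of_indepFun Finset.univ
    (fun j (x : ∀ j, A j) => K j (x j) (s j))]
  · refine Finset.prod_congr rfl fun j _ => ?_
    rw [Measure.bind_apply (hs j) (Kernel.aemeasurable _)]
    exact (measurePreserving_eval μ j).lintegral_comp ((K j).measurable_coe (hs j))
  · exact iIndepFun_pi (X := fun j x => K j x (s j))
      fun j => ((K j).measurable_coe (hs j)).aemeasurable
  · exact fun j => ((K j).measurable_coe (hs j)).comp (measurable_pi_apply j)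

end ProductMeasures

/-! ### Tests for normalised observations -/

/-- The law `N(g, I)` of an observation rescaled to have unit noise. -/
def unitLaw {d : ℕ} (g : Obs d) : Measure (Obs d) := (stdGaussian (Obs d)).map (fun z => g + z)

instance isProbabilityMeasure_unitLaw {d : ℕ} (g : Obs d) : IsProbabilityMeasure (unitLaw g) :=
  Measure.isProbabilityMeasure_map (by fun_prop)

/-- The signal-to-noise ratio `√(n/m)` of a machine. -/
def noiseScale (n m : ℕ) : ℝ := Real.sqrt ((n : ℝ) / (m : ℝ))

lemma localLaw_map_smul {n m d : ℕ} (hn : 1 ≤ n) (hm : 1 ≤ m) (f : Obs d) :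
    (localLaw n m d f).map (fun x => noiseScale n m • x) = unitLaw (noiseScale n m • f) := by
  unfold localLaw unitLaw noiseScale
  rw [Measure.map_map (by fun_prop) (by fun_prop)]
  congr 1
  ext1 z
  have h : Real.sqrt ((n : ℝ) / m) * Real.sqrt ((m : ℝ) / n) = 1 := by
    have hn' : (0 : ℝ) < n := by exact_mod_cast hn
    have hm' : (0 : ℝ) < m := by exact_mod_cast hm
    rw [← Real.sqrt_mul (by positivity), div_mul_div_cancel₀ hm'.ne', div_self hn'.ne',
      Real.sqrt_one]
  simp only [Function.comp_apply, smul_add, smul_smul, h, one_smul]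

/-- `Testable ι d b ε S`: machines indexed by `ι`, each of which observes an independent copy of
`N(g, I)` in `ℝ^d` and sends `b` bits produced with private randomness, allow to test `g = 0`
against `g ∈ S` with both error probabilities at most `ε`. The set `R` is the rejection region. -/
def Testable (ι : Type*) [Fintype ι] (d b : ℕ) (ε : ℝ≥0∞) (S : Set (Obs d)) : Prop :=
  ∃ K : ι → Kernel (Obs d) (Fin b → Bool), (∀ j, IsMarkovKernel (K j)) ∧
    ∃ R : Set (ι → Fin b → Bool),
      Measure.pi (fun j => K j ∘ₘ unitLaw 0) R ≤ ε ∧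
      ∀ g ∈ S, Measure.pi (fun j => K j ∘ₘ unitLaw g) Rᶜ ≤ ε

namespace Testable

lemma pi_transcript_map_comp_injective {ι κ : Type*} [Fintype ι] [Fintype κ] {d b : ℕ}
    (K : ι → Kernel (Obs d) (Fin b → Bool)) [∀ j, IsMarkovKernel (K j)] {f : κ → ι}
    (hf : Function.Injective f) (g : Obs d) :
    (Measure.pi fun j => K j ∘ₘ unitLaw g).map (fun y k => y (f k)) =
      Measure.pi fun k => K (f k) ∘ₘ unitLaw g :=
  pi_map_comp_injective (fun j => K j ∘ₘ unitLaw g) hf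

variable {ι κ : Type*} [Fintype ι] [Fintype κ] {d b : ℕ} {ε ε' : ℝ≥0∞} {S T : Set (Obs d)}

lemma subset (h : Testable ι d b ε S) (hT : T ⊆ S) : Testable ι d b ε T := by
  obtain ⟨K, hK, R, h0, h1⟩ := h
  exact ⟨K, hK, R, h0, fun g hg => h1 g (hT hg)⟩

lemma mono_error (h : Testable ι d b ε S) (hε : ε ≤ ε') : Testable ι d b ε' S := by
  obtain ⟨K, hK, R, h0, h1⟩ := h
  exact ⟨K, hK, R, h0.trans hε, fun g hg => (h1 g hg).trans hε⟩

/-- Two disjoint groups of machines run their own tests, and the null hypothesis is rejected as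
soon as one of them rejects. -/
lemma union (h : Testable ι d b ε S) (h' : Testable κ d b ε' T) :
    Testable (ι ⊕ κ) d b (ε + ε') (S ∪ T) := by
  obtain ⟨K, hK, R, h0, h1⟩ := h
  obtain ⟨K', hK', R', h0', h1'⟩ := h'
  obtain ⟨L, hLl, hLr⟩ : ∃ L : ι ⊕ κ → Kernel (Obs d) (Fin b → Bool),
      (∀ j, L (Sum.inl j) = K j) ∧ ∀ j, L (Sum.inr j) = K' j :=
    ⟨Sum.elim K K', fun _ => rfl, fun _ => rfl⟩
  have hM : ∀ j, IsMarkovKernel (L j) := by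
    rintro (j | j)
    · rw [hLl]; exact hK j
    · rw [hLr]; exact hK' j
  have hl : ∀ g : Obs d, (Measure.pi fun j => L j ∘ₘ unitLaw g).map
      (fun y j => y (Sum.inl j)) = Measure.pi fun j => K j ∘ₘ unitLaw g := fun g => by
    rw [pi_transcript_map_comp_injective L Sum.inl_injective g]
    simp_rw [hLl]
  have hr : ∀ g : Obs d, (Measure.pi fun j => L j ∘ₘ unitLaw g).map
      (fun y j => y (Sum.inr j)) = Measure.pi fun j => K' j ∘ₘ unitLaw g := fun g => by
    rw [pi_transcript_map_comp_injective L Sum.inr_injective g]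
    simp_rw [hLr]
  refine ⟨L, hM, (fun y j => y (Sum.inl j)) ⁻¹' R ∪ (fun y j => y (Sum.inr j)) ⁻¹' R',
    ?_, ?_⟩
  · refine (measure_union_le _ _).trans (add_le_add ?_ ?_)
    · rwa [← Measure.map_apply (by fun_prop) (Set.toFinite R).measurableSet, hl]
    · rwa [← Measure.map_apply (by fun_prop) (Set.toFinite R').measurableSet, hr]
  · rintro g (hg | hg)
    · refine (measure_mono (t := (fun y j => y (Sum.inl j)) ⁻¹' Rᶜ) ?_).trans
        (?_ : _ ≤ ε) |>.trans le_self_add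
      · exact fun y hy hy' => hy (Or.inl hy')
      · rw [← Measure.map_apply (by fun_prop) (Set.toFinite _).measurableSet, hl]
        exact h1 g hg
    · refine (measure_mono (t := (fun y j => y (Sum.inr j)) ⁻¹' R'ᶜ) ?_).trans
        (?_ : _ ≤ ε') |>.trans le_add_self
      · exact fun y hy hy' => hy (Or.inr hy')
      · rw [← Measure.map_apply (by fun_prop) (Set.toFinite _).measurableSet, hr]
        exact h1' g hg

/-- Supplementary machines may stay idle. -/
lemma of_card_le (h : Testable ι d b ε S) (hc : Fintype.card ι ≤ Fintype.card κ) :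
    Testable κ d b ε S := by
  obtain ⟨K, hK, R, h0, h1⟩ := h
  obtain ⟨e⟩ := Function.Embedding.nonempty_of_card_le hc
  set K' : κ → Kernel (Obs d) (Fin b → Bool) :=
    Function.extend e K (fun _ => Kernel.const _ (Measure.dirac fun _ => false)) with hK'
  have he : ∀ j, K' (e j) = K j := fun j => e.injective.extend_apply _ _ _
  have hM : ∀ j, IsMarkovKernel (K' j) := by
    intro j
    by_cases hj : ∃ i, e i = j
    · obtain ⟨i, rfl⟩ := hj
      rw [he]
      exact hK i
    · rw [hK', Function.extend_apply' _ _ _ hj]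
      infer_instance
  have hl : ∀ g : Obs d, (Measure.pi fun j => K' j ∘ₘ unitLaw g).map
      (fun y j => y (e j)) = Measure.pi fun j => K j ∘ₘ unitLaw g := fun g => by
    rw [pi_transcript_map_comp_injective K' e.injective g]
    simp_rw [he]
  refine ⟨K', hM, (fun y j => y (e j)) ⁻¹' R, ?_, fun g hg => ?_⟩
  · rwa [← Measure.map_apply (by fun_prop) (Set.toFinite R).measurableSet, hl]
  · rw [← Set.preimage_compl, ← Measure.map_apply (by fun_prop) (Set.toFinite _).measurableSet, hl]
    exact h1 g hg

/-- Machines that compute their bits deterministically. -/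
lemma of_measurable {φ : ι → Obs d → Fin b → Bool} (hφ : ∀ j, Measurable (φ j))
    (R : Set (ι → Fin b → Bool))
    (h0 : Measure.pi (fun _ : ι => unitLaw (0 : Obs d)) {x | (fun j => φ j (x j)) ∈ R} ≤ ε)
    (h1 : ∀ g ∈ S, Measure.pi (fun _ : ι => unitLaw g) {x | (fun j => φ j (x j)) ∉ R} ≤ ε) :
    Testable ι d b ε S := by
  have key : ∀ (g : Obs d) (R : Set (ι → Fin b → Bool)),
      Measure.pi (fun j => Kernel.deterministic (φ j) (hφ j) ∘ₘ unitLaw g) R =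
        Measure.pi (fun _ : ι => unitLaw g) {x | (fun j => φ j (x j)) ∈ R} := by
    intro g R
    have : ∀ j, Kernel.deterministic (φ j) (hφ j) ∘ₘ unitLaw g = (unitLaw g).map (φ j) := fun j =>
      Measure.deterministic_comp_eq_map (hφ j)
    simp_rw [this]
    have hp : ∀ j, IsProbabilityMeasure ((unitLaw g).map (φ j)) := fun j =>
      Measure.isProbabilityMeasure_map (hφ j).aemeasurable
    rw [← Measure.pi_map_pi fun j => (hφ j).aemeasurable,
      Measure.map_apply (by fun_prop) (Set.toFinite R).measurableSet]
    rfl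
  refine ⟨fun j => Kernel.deterministic (φ j) (hφ j), fun j => inferInstance, R, ?_, ?_⟩
  · rw [key]; exact h0
  · intro g hg
    rw [key]; exact h1 g hg

end Testable

/-! ### From tests for normalised observations to protocols -/

instance {m d b : ℕ} (P : PrivateCoinProtocol m d b) : IsMarkovKernel P.transcriptKernel := by
  unfold PrivateCoinProtocol.transcriptKernel; infer_instance

instance {m d b : ℕ} (P : PublicCoinProtocol m d b) : IsMarkovKernel P.transcriptKernel := by
  unfold PublicCoinProtocol.transcriptKernel; infer_instance

lemma jointLaw_private_apply {n m d b : ℕ} (P : PrivateCoinProtocol m d b) (f : Obs d) (i : Fin 2) :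
    P.jointLaw n f {ω | P.T ω.2 = i} =
      Measure.pi (fun j => P.K j ∘ₘ localLaw n m d f) {y | P.T y = i} := by
  have hmeas : MeasurableSet {y | P.T y = i} := (Set.toFinite _).measurableSet
  have h1 : {ω : (Fin m → Obs d) × (∀ j, P.Y j) | P.T ω.2 = i} =
      Prod.snd ⁻¹' {y | P.T y = i} := rfl
  unfold PrivateCoinProtocol.jointLaw
  rw [h1, ← Measure.snd_apply hmeas, Measure.snd_compProd, ← productKernel_comp_pi]
  rfl

/-- Given the value `u` of the public coin, the protocol is a private coin protocol. -/
lemma jointLaw_public_apply {n m d b : ℕ} (P : PublicCoinProtocol m d b) (f : Obs d) (i : Fin 2) :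
    P.jointLaw n f {ω | P.T ω.2 = i} =
      ∫⁻ u, Measure.pi (fun j => (P.K j).comap (fun x => (x, u)) (by fun_prop) ∘ₘ localLaw n m d f)
        {y | P.T y = i} ∂P.PU := by
  have hmeas : MeasurableSet {y | P.T y = i} := (Set.toFinite _).measurableSet
  unfold PublicCoinProtocol.jointLaw
  have h1 : {ω : ((Fin m → Obs d) × P.U) × (∀ j, P.Y j) | P.T ω.2 = i} =
      Prod.snd ⁻¹' {y | P.T y = i} := rfl
  rw [h1, ← Measure.snd_apply hmeas, Measure.snd_compProd,
    Measure.bind_apply hmeas (Kernel.aemeasurable _),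
    lintegral_prod_symm' _ (P.transcriptKernel.measurable_coe hmeas)]
  refine lintegral_congr fun u => ?_
  rw [← productKernel_comp_pi, Measure.bind_apply hmeas (Kernel.aemeasurable _)]
  rfl

lemma Testable.exists_private {n m d b : ℕ} (hn : 1 ≤ n) (hm : 1 ≤ m) {ε : ℝ≥0∞}
    {S : Set (Obs d)} (hS : Testable (Fin m) d b ε S) {ρ : ℝ}
    (hρ : ∀ f : Obs d, ρ ≤ ‖f‖ → noiseScale n m • f ∈ S) :
    ∃ P : PrivateCoinProtocol m d b, P.risk n ρ ≤ ε + ε := by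
  classical
  obtain ⟨K, hK, R, h0, h1⟩ := hS
  let P : PrivateCoinProtocol m d b :=
    { Y := fun _ => Fin b → Bool
      card_le := fun _ => by simp
      K := fun j => (K j).comap (fun x => noiseScale n m • x) (by fun_prop)
      T := fun y => if y ∈ R then 1 else 0 }
  have hlaw : ∀ f j, P.K j ∘ₘ localLaw n m d f = K j ∘ₘ unitLaw (noiseScale n m • f) := by
    intro f j
    rw [← localLaw_map_smul hn hm f, ← Measure.deterministic_comp_eq_map (by fun_prop),
      Measure.comp_assoc, Kernel.comp_deterministic_eq_comap]
  have hT1 : {y : Fin m → Fin b → Bool | P.T y = 1} = R := by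
    ext y
    by_cases hy : y ∈ R <;> simp [P, hy]
  have hT0 : {y : Fin m → Fin b → Bool | P.T y = 0} = Rᶜ := by
    ext y
    by_cases hy : y ∈ R <;> simp [P, hy]
  refine ⟨P, add_le_add ?_ (iSup₂_le fun f hf => ?_)⟩
  · rw [jointLaw_private_apply, hT1]
    simp_rw [hlaw, smul_zero]
    exact h0
  · rw [jointLaw_private_apply, hT0]
    simp_rw [hlaw]
    exact h1 _ (hρ f hf)

/-- A public coin `u` selects a linear compression `A · u` of the observations which maps
`N(g, I)` to `N(A g u, I)`; the compressed observations are then tested with private coins. -/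
lemma Testable.exists_public {n m d d' b : ℕ} (hn : 1 ≤ n) (hm : 1 ≤ m) {ε δ : ℝ≥0∞}
    {S : Set (Obs d')} (hS : Testable (Fin m) d' b ε S) {ρ : ℝ}
    {U : Type} [MeasurableSpace U] (PU : Measure U) [IsProbabilityMeasure PU]
    (A : Obs d → U → Obs d') (hA : Measurable (Function.uncurry A)) (hA0 : ∀ u, A 0 u = 0)
    (hAlaw : ∀ g, ∀ᵐ u ∂PU, (unitLaw g).map (fun x => A x u) = unitLaw (A g u))
    (hρ : ∀ f : Obs d, ρ ≤ ‖f‖ → PU {u | A (noiseScale n m • f) u ∉ S} ≤ δ) :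
    ∃ P : PublicCoinProtocol m d b, P.risk n ρ ≤ ε + (ε + δ) := by
  classical
  obtain ⟨K, hK, R, h0, h1⟩ := hS
  have hA' : Measurable fun p : Obs d × U => A (noiseScale n m • p.1) p.2 :=
    hA.comp ((measurable_fst.const_smul (noiseScale n m)).prodMk measurable_snd)
  let KP : Fin m → Kernel (Obs d × U) (Fin b → Bool) := fun j => (K j).comap _ hA'
  have hKP : ∀ j, IsMarkovKernel (KP j) := fun j => Kernel.IsMarkovKernel.comap _ hA'
  let P : PublicCoinProtocol m d b :=
    { Y := fun _ => Fin b → Bool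
      card_le := fun _ => by simp
      U := U
      PU := PU
      K := KP
      T := fun y => if y ∈ R then 1 else 0 }
  have hAu : ∀ u, Measurable fun x => A x u := fun u => hA.comp measurable_prodMk_right
  have hlaw : ∀ f : Obs d, ∀ᵐ u ∂PU, ∀ j,
      (KP j).comap (fun x => (x, u)) (by fun_prop) ∘ₘ localLaw n m d f =
        K j ∘ₘ unitLaw (A (noiseScale n m • f) u) := by
    intro f
    filter_upwards [hAlaw (noiseScale n m • f)] with u hu j
    have hm' : Measurable fun x : Obs d => noiseScale n m • x := by fun_prop
    rw [← hu, ← localLaw_map_smul hn hm f, Measure.map_map (hAu u) hm',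
      ← Measure.deterministic_comp_eq_map ((hAu u).comp hm'),
      Measure.comp_assoc, Kernel.comp_deterministic_eq_comap]
    rfl
  have hT1 : {y : Fin m → Fin b → Bool | P.T y = 1} = R := by
    ext y
    by_cases hy : y ∈ R <;> simp [P, hy]
  have hT0 : {y : Fin m → Fin b → Bool | P.T y = 0} = Rᶜ := by
    ext y
    by_cases hy : y ∈ R <;> simp [P, hy]
  refine ⟨P, add_le_add ?_ (iSup₂_le fun f hf => ?_)⟩
  · rw [jointLaw_public_apply]
    refine (lintegral_mono_ae (g := fun _ => ε) ?_).trans (by simp)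
    filter_upwards [hlaw 0] with u hu
    change Measure.pi (fun j => (KP j).comap (fun x => (x, u)) _ ∘ₘ localLaw n m d 0)
      {y : Fin m → Fin b → Bool | P.T y = 1} ≤ ε
    rw [hT1]
    have hu' := funext hu
    simp only [smul_zero, hA0] at hu'
    rw [hu']
    exact h0
  · rw [jointLaw_public_apply]
    set B : Set U := {u | A (noiseScale n m • f) u ∉ S}
    set B' := toMeasurable PU B with hB'
    refine (lintegral_mono_ae (g := fun u => ε + B'.indicator 1 u) ?_).trans ?_
    · filter_upwards [hlaw f] with u hu
      change Measure.pi (fun j => (KP j).comap (fun x => (x, u)) _ ∘ₘ localLaw n m d f)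
        {y : Fin m → Fin b → Bool | P.T y = 0} ≤ _
      rw [hT0]
      simp_rw [hu]
      by_cases hS : A (noiseScale n m • f) u ∈ S
      · exact (h1 _ hS).trans le_self_add
      · have : u ∈ B' := subset_toMeasurable _ _ hS
        simp only [this, Set.indicator_of_mem, Pi.one_apply]
        exact prob_le_one.trans le_add_self
    · rw [lintegral_add_left measurable_const,
        lintegral_indicator_one (measurableSet_toMeasurable _ _), measure_toMeasurable]
      simpa using add_le_add_right (hρ f hf) ε

/-! ### Chebyshev tests -/

section Chebyshev

variable {Ω : Type*} [MeasurableSpace Ω] {P : Measure Ω} [IsProbabilityMeasure P] {Q : Ω → ℝ}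
  {ε t m₀ : ℝ}

lemma measure_add_le_le_of_variance_le (hQ : MemLp Q 2 P) (ht : 0 < t) (hm : ∫ ω, Q ω ∂P = m₀)
    (hv : Var[Q; P] ≤ ε * t ^ 2) : P {ω | m₀ + t ≤ Q ω} ≤ ENNReal.ofReal ε := by
  refine (measure_mono ?_).trans ((meas_ge_le_variance_div_sq hQ ht).trans
    (ENNReal.ofReal_le_ofReal ?_))
  · intro ω hω
    simp only [Set.mem_ofPred_eq, hm] at hω ⊢
    exact (le_abs_self _).trans' (by linarith)
  · rw [div_le_iff₀ (by positivity)]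
    exact hv

lemma measure_not_add_le_le_of_variance_le (hQ : MemLp Q 2 P) (ht : 0 < t)
    (hm : m₀ + 2 * t ≤ ∫ ω, Q ω ∂P) (hv : 4 * Var[Q; P] ≤ ε * (∫ ω, Q ω ∂P - m₀) ^ 2) :
    P {ω | ¬ (m₀ + t ≤ Q ω)} ≤ ENNReal.ofReal ε := by
  have hpos : 0 < (∫ ω, Q ω ∂P - m₀) / 2 := by linarith
  refine (measure_mono ?_).trans ((meas_ge_le_variance_div_sq hQ hpos).trans
    (ENNReal.ofReal_le_ofReal ?_))
  · intro ω hω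
    simp only [Set.mem_ofPred_eq, not_le] at hω ⊢
    rw [abs_sub_comm]
    exact (le_abs_self _).trans' (by linarith)
  · rw [div_le_iff₀ (by positivity)]
    nlinarith

end Chebyshev

/-! ### One-bit tests -/

/-- A single machine communicates the outcome of its own test. -/
lemma Testable.of_local {d b : ℕ} (hb : 1 ≤ b) {ε : ℝ≥0∞} {S : Set (Obs d)} {R : Set (Obs d)}
    (hR : MeasurableSet R) (h0 : unitLaw 0 R ≤ ε) (h1 : ∀ g ∈ S, unitLaw g Rᶜ ≤ ε) :
    Testable (Fin 1) d b ε S := by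
  classical
  have key : ∀ (g : Obs d) (A : Set (Obs d)), MeasurableSet A →
      Measure.pi (fun _ : Fin 1 => unitLaw g) {x | x 0 ∈ A} = unitLaw g A := by
    intro g A hA
    exact (measurePreserving_eval (fun _ : Fin 1 => unitLaw g) 0).measure_preimage
      hA.nullMeasurableSet
  have hφ : Measurable fun (x : Obs d) (_ : Fin b) => decide (x ∈ R) := by
    refine measurable_pi_lambda _ fun _ => ?_
    exact measurable_to_bool (by
      convert hR using 1
      ext x
      simp)
  refine Testable.of_measurable (fun _ => hφ) {y | y 0 ⟨0, hb⟩ = true} ?_ fun g hg => ?_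
  · simpa [key 0 R hR] using h0
  · have := h1 g hg
    rw [← key g _ hR.compl] at this
    simpa using this

/-- The channel which, on input `x`, sends in each of its `b` bits the value of one and the same
Bernoulli variable with parameter `(1 + h x) / 2`. -/
def bernoulliChannel {d : ℕ} (b : ℕ) (h : Obs d → ℝ) : Kernel (Obs d) (Fin b → Bool) :=
  (Kernel.id ×ₖ Kernel.const _ (volume : Measure unitInterval)).map
    (fun p _ => decide ((p.2 : ℝ) ≤ (1 + h p.1) / 2))

/-- The sign `±1` encoded by a bit. -/
def bitSign (y : Bool) : ℝ := if y then 1 else -1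

lemma bitSign_sq (y : Bool) : bitSign y ^ 2 = 1 := by
  cases y <;> simp [bitSign]

lemma abs_bitSign (y : Bool) : |bitSign y| = 1 := by
  cases y <;> simp [bitSign]

lemma measurable_bitSign : Measurable bitSign := measurable_of_finite _

section BernoulliChannel

variable {d b : ℕ} {h : Obs d → ℝ}

lemma measurable_bernoulli_bits (hh : Measurable h) :
    Measurable fun (p : Obs d × unitInterval) (_ : Fin b) =>
      decide ((p.2 : ℝ) ≤ (1 + h p.1) / 2) := by
  refine measurable_pi_lambda _ fun _ => measurable_to_bool ?_
  have : MeasurableSet {p : Obs d × unitInterval | (p.2 : ℝ) ≤ (1 + h p.1) / 2} :=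
    measurableSet_le (by fun_prop) (by fun_prop)
  convert this using 1
  ext x
  simp

lemma isMarkovKernel_bernoulliChannel (hh : Measurable h) :
    IsMarkovKernel (bernoulliChannel b h) :=
  Kernel.IsMarkovKernel.map _ (measurable_bernoulli_bits hh)

lemma bernoulliChannel_comp (hh : Measurable h) (P : Measure (Obs d)) [IsProbabilityMeasure P] :
    bernoulliChannel b h ∘ₘ P = (P.prod (volume : Measure unitInterval)).map
      (fun p _ => decide ((p.2 : ℝ) ≤ (1 + h p.1) / 2)) := by
  rw [bernoulliChannel, ← Measure.map_comp _ _ (measurable_bernoulli_bits hh),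
    ← Measure.compProd_eq_comp_prod, Measure.compProd_const]

lemma integral_bitSign_bernoulliChannel (hh : Measurable h) (h1 : ∀ x, |h x| ≤ 1)
    (P : Measure (Obs d)) [IsProbabilityMeasure P] (i : Fin b) :
    ∫ y, bitSign (y i) ∂(bernoulliChannel b h ∘ₘ P) = ∫ x, h x ∂P := by
  have hm : Measurable fun y : Fin b → Bool => bitSign (y i) := measurable_of_finite _
  have hm' := hm.comp (measurable_bernoulli_bits (b := b) hh)
  rw [bernoulliChannel_comp hh, integral_map (measurable_bernoulli_bits hh).aemeasurable
    hm.aestronglyMeasurable, integral_prod]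
  · refine integral_congr_ae (Filter.Eventually.of_forall fun x => ?_)
    have hx := abs_le.1 (h1 x)
    have hp : (1 + h x) / 2 ∈ unitInterval := ⟨by linarith [hx.1], by linarith [hx.2]⟩
    have hs : ∀ u : unitInterval, bitSign (decide ((u : ℝ) ≤ (1 + h x) / 2)) =
        2 * (Set.Iic (⟨_, hp⟩ : unitInterval)).indicator 1 u - 1 := by
      intro u
      by_cases hu : (u : ℝ) ≤ (1 + h x) / 2
      · have hu' : u ∈ Set.Iic (⟨_, hp⟩ : unitInterval) := hu
        norm_num [bitSign, hu, hu']
      · have hu' : u ∉ Set.Iic (⟨_, hp⟩ : unitInterval) := hu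
        simp only [bitSign, hu, hu', not_false_eq_true, Set.indicator_of_notMem]
        norm_num
    simp only [hs]
    rw [integral_sub, integral_const_mul, integral_indicator_one measurableSet_Iic,
      measureReal_def, unitInterval.volume_Iic, ENNReal.toReal_ofReal hp.1]
    · simp only [integral_const, probReal_univ, smul_eq_mul, one_mul]
      ring
    · exact (((integrable_const (1 : ℝ)).indicator measurableSet_Iic).const_mul 2)
    · exact integrable_const _
  · refine Integrable.of_bound hm'.aestronglyMeasurable 1 (Filter.Eventually.of_forall fun p => ?_)
    rw [Real.norm_eq_abs]
    exact (abs_bitSign _).le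

end BernoulliChannel

/-- `M` machines estimate the mean of a bounded function `h` by one random bit each: signals for
which this mean is at least a multiple of `1 / √M` are detected. -/
lemma Testable.of_bounded_mean {d b M : ℕ} (hb : 1 ≤ b) (hM : 1 ≤ M) {h : Obs d → ℝ}
    (hh : Measurable h) (h1 : ∀ x, |h x| ≤ 1) (h0 : ∫ x, h x ∂(unitLaw 0) = 0) {ε : ℝ}
    (hε : 0 < ε) :
    Testable (Fin M) d b (ENNReal.ofReal ε)
      {g | 2 / Real.sqrt (ε * M) ≤ ∫ x, h x ∂(unitLaw g)} := by
  have hM0 : (0 : ℝ) < M := by exact_mod_cast hM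
  have hk := isMarkovKernel_bernoulliChannel (b := b) hh
  set i₀ : Fin b := ⟨0, hb⟩
  set P : Obs d → Measure (Fin M → Fin b → Bool) := fun g =>
    Measure.pi fun _ => bernoulliChannel b h ∘ₘ unitLaw g with hP
  set Q : (Fin M → Fin b → Bool) → ℝ := fun y => ∑ j, bitSign (y j i₀) with hQ
  have hmem : ∀ g, MemLp (fun y : Fin b → Bool => bitSign (y i₀)) 2
      (bernoulliChannel b h ∘ₘ unitLaw g) := fun g =>
    MemLp.of_bound (measurable_of_finite _).aestronglyMeasurable 1
      (Filter.Eventually.of_forall fun y => by rw [Real.norm_eq_abs]; exact (abs_bitSign _).le)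
  have hQ2 : ∀ g, MemLp Q 2 (P g) := fun g =>
    memLp_finsetSum _ fun j _ => (hmem g).comp_measurePreserving
      (measurePreserving_eval (fun _ : Fin M => bernoulliChannel b h ∘ₘ unitLaw g) j)
  have hmean : ∀ g, ∫ y, Q y ∂(P g) = M * ∫ x, h x ∂(unitLaw g) := by
    intro g
    simp only [hQ, hP]
    rw [integral_finsetSum]
    · have : ∀ j : Fin M, ∫ y : Fin M → Fin b → Bool, bitSign (y j i₀) ∂(P g) =
          ∫ x, h x ∂(unitLaw g) := by
        intro j
        rw [← integral_bitSign_bernoulliChannel hh h1 (unitLaw g) i₀]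
        exact integral_comp_eval (μ := fun _ : Fin M => bernoulliChannel b h ∘ₘ unitLaw g)
          (f := fun y : Fin b → Bool => bitSign (y i₀)) (i := j)
          (measurable_of_finite _).aestronglyMeasurable
      simp only [hP] at this
      simp [this]
    · intro j _
      exact integrable_comp_eval (μ := fun _ : Fin M => bernoulliChannel b h ∘ₘ unitLaw g)
        (f := fun y : Fin b → Bool => bitSign (y i₀)) ((hmem g).integrable (by norm_num))
  have hvar : ∀ g, Var[Q; P g] ≤ M := by
    intro g
    have : Q = ∑ j, fun y : Fin M → Fin b → Bool => bitSign (y j i₀) := by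
      ext y; simp [hQ]
    rw [this, variance_sum_pi (X := fun _ (y : Fin b → Bool) => bitSign (y i₀)) fun _ => hmem g]
    refine (Finset.sum_le_card_nsmul _ _ 1 fun j _ => ?_).trans (by simp)
    refine (variance_le_expectation_sq (measurable_of_finite _).aestronglyMeasurable).trans ?_
    simp [bitSign_sq]
  have hsq : Real.sqrt (ε * M) * Real.sqrt (ε * M) = ε * M :=
    Real.mul_self_sqrt (by positivity)
  have hs0 : 0 < Real.sqrt (ε * M) := Real.sqrt_pos.2 (by positivity)
  have ht : (0 : ℝ) < M / Real.sqrt (ε * M) := by positivity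
  refine ⟨fun _ => bernoulliChannel b h, fun _ => hk,
    {y | 0 + M / Real.sqrt (ε * M) ≤ Q y}, ?_, fun g hg => ?_⟩
  · refine measure_add_le_le_of_variance_le (hQ2 0) ht (by rw [hmean, h0, mul_zero]) ?_
    refine (hvar 0).trans (le_of_eq ?_)
    rw [div_pow, sq (Real.sqrt _), hsq]
    field_simp
  · have hg' : 0 + 2 * (M / Real.sqrt (ε * M)) ≤ M * ∫ x, h x ∂(unitLaw g) := by
      have := mul_le_mul_of_nonneg_left (Set.mem_ofPred_eq ▸ hg) hM0.le
      calc _ = M * (2 / Real.sqrt (ε * M)) := by ring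
        _ ≤ _ := this
    refine measure_not_add_le_le_of_variance_le (hQ2 g) ht (by rwa [hmean]) ?_
    rw [hmean, sub_zero]
    have h2 := pow_le_pow_left₀ (by positivity) hg' 2
    have h3 : (0 + 2 * (M / Real.sqrt (ε * M))) ^ 2 = 4 * M / ε := by
      rw [zero_add, mul_pow, div_pow, sq (Real.sqrt _), hsq]
      field_simp
      norm_num
    rw [h3, div_le_iff₀ hε] at h2
    linarith [hvar g]

/-! ### Coordinates of a Gaussian observation -/

lemma unitLaw_eq_map_pi {d : ℕ} (g : Obs d) :
    unitLaw g = (Measure.pi fun i => gaussianReal (g i) 1).map (WithLp.toLp 2) := by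
  have h : ∀ i, (gaussianReal 0 1).map (fun z => g i + z) = gaussianReal (g i) 1 := fun i => by
    rw [gaussianReal_map_const_add, zero_add]
  simp_rw [← h]
  have hp : ∀ i, IsProbabilityMeasure ((gaussianReal 0 1).map (fun z => g i + z)) := fun i =>
    Measure.isProbabilityMeasure_map (by fun_prop)
  rw [← Measure.pi_map_pi (fun i => by fun_prop), unitLaw, ← map_pi_eq_stdGaussian,
    Measure.map_map (by fun_prop) (by fun_prop), Measure.map_map (by fun_prop) (by fun_prop)]
  rfl

/-! ### The local test -/

lemma one_add_sq_div_two_le_cosh (x : ℝ) : 1 + x ^ 2 / 2 ≤ Real.cosh x := by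
  have h1 : Real.cosh x = 1 + 2 * Real.sinh (x / 2) ^ 2 := by
    have := Real.cosh_two_mul (x / 2)
    rw [Real.cosh_sq, show 2 * (x / 2) = x by ring] at this
    linarith
  have h2 : (x / 2) ^ 2 ≤ Real.sinh (x / 2) ^ 2 := by
    refine sq_le_sq.2 ?_
    rw [Real.abs_sinh]
    exact Real.self_le_sinh_iff.2 (abs_nonneg _)
  rw [h1]
  linarith

/-- From `cosh x = 2 cosh² (x / 2) - 1`, a bound that sees the fourth power. -/
lemma sq_add_pow_four_le_cosh_sub_one (x : ℝ) : x ^ 2 / 2 + x ^ 4 / 32 ≤ Real.cosh x - 1 := by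
  have h := one_add_sq_div_two_le_cosh (x / 2)
  have h1 : Real.cosh x = 2 * Real.cosh (x / 2) ^ 2 - 1 := by
    have := Real.cosh_two_mul (x / 2)
    rw [Real.sinh_sq, show 2 * (x / 2) = x by ring] at this
    linarith
  have h2 := pow_le_pow_left₀ (by positivity) h 2
  rw [h1]
  nlinarith

lemma integrable_cosh_gaussianReal (r l : ℝ) :
    Integrable (fun x => Real.cosh (l * x)) (gaussianReal r 1) := by
  simp only [Real.cosh_eq]
  refine ((integrable_exp_mul_gaussianReal l).add ?_).div_const 2
  simpa using integrable_exp_mul_gaussianReal (μ := r) (v := 1) (-l)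

lemma integral_cosh_gaussianReal (r l : ℝ) :
    ∫ x, Real.cosh (l * x) ∂(gaussianReal r 1) = Real.exp (l ^ 2 / 2) * Real.cosh (l * r) := by
  have h : ∀ l : ℝ, ∫ x, Real.exp (l * x) ∂(gaussianReal r 1) = Real.exp (r * l + l ^ 2 / 2) := by
    intro l
    have := congrFun (mgf_id_gaussianReal (μ := r) (v := 1)) l
    simpa [mgf] using this
  have h' := integrable_exp_mul_gaussianReal (μ := r) (v := 1) (-l)
  simp only [Real.cosh_eq, ← neg_mul]
  rw [integral_div, integral_add (integrable_exp_mul_gaussianReal l) h', h, h, Real.exp_add,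
    Real.exp_add, neg_sq, mul_neg, mul_comm r l, neg_mul]
  ring

lemma memLp_cosh_gaussianReal (r l : ℝ) :
    MemLp (fun x => Real.cosh (l * x)) 2 (gaussianReal r 1) := by
  rw [memLp_two_iff_integrable_sq (by fun_prop)]
  have : (fun x => Real.cosh (l * x) ^ 2) = fun x => (Real.cosh (2 * l * x) + 1) / 2 := by
    ext x
    have := Real.cosh_two_mul (l * x)
    rw [Real.sinh_sq] at this
    rw [mul_assoc, this]
    ring
  rw [this]
  exact ((integrable_cosh_gaussianReal r (2 * l)).add (integrable_const 1)).div_const 2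

lemma variance_cosh_gaussianReal_le (r l : ℝ) :
    Var[fun x => Real.cosh (l * x); gaussianReal r 1] ≤
      (Real.exp (2 * l ^ 2) - Real.exp (l ^ 2)) * Real.cosh (l * r) ^ 2 := by
  have hsq : ∀ x, Real.cosh (l * x) ^ 2 = (Real.cosh (2 * l * x) + 1) / 2 := by
    intro x
    have := Real.cosh_two_mul (l * x)
    rw [Real.sinh_sq] at this
    rw [mul_assoc, this]
    ring
  rw [variance_eq_sub (memLp_cosh_gaussianReal r l)]
  simp only [Pi.pow_apply, hsq]
  rw [integral_div, integral_add (integrable_cosh_gaussianReal r (2 * l)) (integrable_const 1),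
    integral_cosh_gaussianReal, integral_cosh_gaussianReal, mul_pow (Real.exp _), hsq r,
    ← Real.exp_nat_mul]
  have h1 : (1 : ℝ) ≤ Real.exp (2 * l ^ 2) := Real.one_le_exp (by positivity)
  have e1 : (2 * l) ^ 2 / 2 = 2 * l ^ 2 := by ring
  have e2 : ((2 : ℕ) : ℝ) * (l ^ 2 / 2) = l ^ 2 := by push_cast; ring
  rw [e1, e2]
  simp only [integral_const, probReal_univ, smul_eq_mul, mul_one]
  nlinarith

/-- One machine alone, using the statistic `∑ i, cosh (l * x i)` with `l` small, detects signals of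
squared norm, or of fourth power of the `ℓ⁴` norm, of order `√d`. The exponential moments are
explicit, and the relative variance of `cosh (l * x i)` is small for `l` small. -/
lemma exists_local_test {ε : ℝ} (hε : 0 < ε) : ∃ C : ℝ, 0 < C ∧ ∀ d b : ℕ, 1 ≤ d → 1 ≤ b →
    Testable (Fin 1) d b (ENNReal.ofReal ε)
      {g | C * Real.sqrt d ≤ ∑ i, g i ^ 2 ∨ C * Real.sqrt d ≤ ∑ i, g i ^ 4} := by
  obtain ⟨l, hl, hη⟩ : ∃ l : ℝ, 0 < l ∧ Real.exp (2 * l ^ 2) - Real.exp (l ^ 2) < ε / 16 := by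
    have hc : ContinuousAt (fun l : ℝ => Real.exp (2 * l ^ 2) - Real.exp (l ^ 2)) 0 := by fun_prop
    have h0 : (fun l : ℝ => Real.exp (2 * l ^ 2) - Real.exp (l ^ 2)) 0 < ε / 16 := by
      simp; positivity
    have := (hc.eventually_lt_const h0).filter_mono (nhdsWithin_le_nhds (s := Set.Ioi 0))
    obtain ⟨l, hl, hl0⟩ := (this.and self_mem_nhdsWithin).exists
    exact ⟨l, hl0, hl⟩
  set η := Real.exp (2 * l ^ 2) - Real.exp (l ^ 2) with hηdef
  have hη0 : 0 ≤ η := sub_nonneg.2 (Real.exp_le_exp.2 (by nlinarith [sq_nonneg l]))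
  refine ⟨4 / l ^ 2 + 64 / l ^ 4, by positivity, fun d b hd hb => ?_⟩
  set s := Real.sqrt d with hs
  have hd0 : (0 : ℝ) < d := by exact_mod_cast hd
  have hs0 : 0 < s := Real.sqrt_pos.2 hd0
  have hss : s ^ 2 = d := Real.sq_sqrt hd0.le
  set e := Real.exp (l ^ 2 / 2) with he
  have he1 : 1 ≤ e := Real.one_le_exp (by positivity)
  set Q : Obs d → ℝ := fun x => ∑ i, Real.cosh (l * x i) with hQ
  have hQm : Measurable Q := by fun_prop
  have hcoord : ∀ (g : Obs d) (i : Fin d), MemLp (fun x => Real.cosh (l * x)) 2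
      (gaussianReal (g i) 1) := fun g i => memLp_cosh_gaussianReal _ _
  have hQpi : ∀ g : Obs d, MemLp (fun x : Fin d → ℝ => ∑ i, Real.cosh (l * x i)) 2
      (Measure.pi fun i => gaussianReal (g i) 1) := fun g =>
    memLp_finsetSum _ fun i _ => (hcoord g i).comp_measurePreserving
      (measurePreserving_eval (fun i => gaussianReal (g i) 1) i)
  have hQ2 : ∀ g, MemLp Q 2 (unitLaw g) := fun g => by
    rw [unitLaw_eq_map_pi, memLp_map_measure_iff hQm.aestronglyMeasurable (by fun_prop)]
    exact hQpi g
  have hmean : ∀ g, ∫ x, Q x ∂(unitLaw g) = e * ∑ i, Real.cosh (l * g i) := by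
    intro g
    rw [unitLaw_eq_map_pi, integral_map (by fun_prop) hQm.aestronglyMeasurable]
    simp only [hQ]
    rw [integral_finsetSum, Finset.mul_sum]
    · refine Finset.sum_congr rfl fun i _ => ?_
      rw [he, ← integral_cosh_gaussianReal]
      exact integral_comp_eval (μ := fun i => gaussianReal (g i) 1)
        (f := fun x => Real.cosh (l * x)) (by fun_prop)
    · intro i _
      exact integrable_comp_eval (μ := fun i => gaussianReal (g i) 1)
        (f := fun x => Real.cosh (l * x)) (integrable_cosh_gaussianReal _ _)
  have hvar : ∀ g, Var[Q; unitLaw g] ≤ η * ∑ i, Real.cosh (l * g i) ^ 2 := by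
    intro g
    rw [unitLaw_eq_map_pi, variance_map hQm.aemeasurable (by fun_prop)]
    have : Q ∘ WithLp.toLp 2 = ∑ i, fun x : Fin d → ℝ => Real.cosh (l * x i) := by
      ext x; simp [hQ]
    rw [this, variance_sum_pi (X := fun _ x => Real.cosh (l * x)) (hcoord g), Finset.mul_sum]
    exact Finset.sum_le_sum fun i _ => variance_cosh_gaussianReal_le _ _
  have hm0 : ∫ x, Q x ∂(unitLaw (0 : Obs d)) = e * d := by
    rw [hmean]; simp
  have ht : 0 < e * s := by positivity
  refine Testable.of_local hb (R := {x | e * d + e * s ≤ Q x})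
    (measurableSet_le measurable_const hQm) ?_ fun g hg => ?_
  · refine measure_add_le_le_of_variance_le (hQ2 0) ht hm0 ((hvar 0).trans ?_)
    simp only [PiLp.zero_apply, mul_zero, Real.cosh_zero, one_pow, Finset.sum_const,
      Finset.card_univ, Fintype.card_fin, nsmul_eq_mul, mul_one]
    rw [mul_pow, hss]
    have : (1 : ℝ) ≤ e ^ 2 := one_le_pow₀ he1
    nlinarith [mul_pos hε hd0]
  · -- `B` is the excess of the mean, up to the factor `e`
    set B := ∑ i, (Real.cosh (l * g i) - 1) with hB
    have hBsum : ∑ i, Real.cosh (l * g i) = d + B := by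
      simp [hB, Finset.sum_sub_distrib]
    have hBlow : l ^ 2 / 2 * ∑ i, g i ^ 2 + l ^ 4 / 32 * ∑ i, g i ^ 4 ≤ B := by
      rw [hB, Finset.mul_sum, Finset.mul_sum, ← Finset.sum_add_distrib]
      refine Finset.sum_le_sum fun i _ => (le_of_eq ?_).trans (sq_add_pow_four_le_cosh_sub_one _)
      ring
    have h2 : 0 ≤ ∑ i, g i ^ 2 := Finset.sum_nonneg fun i _ => by positivity
    have h4 : 0 ≤ ∑ i, g i ^ 4 := Finset.sum_nonneg fun i _ => by positivity
    have hBs : 2 * s ≤ B := by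
      rcases hg with hg | hg
      · have h := mul_le_mul_of_nonneg_left hg (show 0 ≤ l ^ 2 / 2 by positivity)
        have e1 : l ^ 2 / 2 * ((4 / l ^ 2 + 64 / l ^ 4) * s) = 2 * s + 32 / l ^ 2 * s := by
          field_simp; ring
        have : 0 ≤ 32 / l ^ 2 * s := by positivity
        have : 0 ≤ l ^ 4 / 32 * ∑ i, g i ^ 4 := by positivity
        linarith
      · have h := mul_le_mul_of_nonneg_left hg (show 0 ≤ l ^ 4 / 32 by positivity)
        have e1 : l ^ 4 / 32 * ((4 / l ^ 2 + 64 / l ^ 4) * s) = 2 * s + l ^ 2 / 8 * s := by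
          field_simp; ring
        have : 0 ≤ l ^ 2 / 8 * s := by positivity
        have : 0 ≤ l ^ 2 / 2 * ∑ i, g i ^ 2 := by positivity
        linarith
    have hB0 : 0 < B := by linarith
    have hsq : ∑ i, Real.cosh (l * g i) ^ 2 ≤ 2 * (d + B ^ 2) := by
      have h1 : ∑ i, (Real.cosh (l * g i) - 1) ^ 2 ≤ B ^ 2 :=
        Finset.sum_sq_le_sq_sum_of_nonneg fun i _ => sub_nonneg.2 (Real.one_le_cosh _)
      calc ∑ i, Real.cosh (l * g i) ^ 2
          ≤ ∑ i, (2 * 1 + 2 * (Real.cosh (l * g i) - 1) ^ 2) :=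
            Finset.sum_le_sum fun i _ => by nlinarith [sq_nonneg (Real.cosh (l * g i) - 2)]
        _ = 2 * d + 2 * ∑ i, (Real.cosh (l * g i) - 1) ^ 2 := by
            rw [Finset.sum_add_distrib, Finset.mul_sum]
            congr 1
            simp [mul_comm]
        _ ≤ _ := by linarith
    have hmg : ∫ x, Q x ∂(unitLaw g) = e * d + e * B := by rw [hmean, hBsum]; ring
    refine measure_not_add_le_le_of_variance_le (hQ2 g) ht ?_ ?_
    · rw [hmg]
      nlinarith
    · rw [hmg]
      have h1 : Var[Q; unitLaw g] ≤ η * (2 * (d + B ^ 2)) :=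
        (hvar g).trans (mul_le_mul_of_nonneg_left hsq hη0)
      have h3 : (d : ℝ) ≤ B ^ 2 := by rw [← hss]; nlinarith
      have h4 : η * (2 * (d + B ^ 2)) ≤ ε / 16 * (2 * (B ^ 2 + B ^ 2)) :=
        mul_le_mul hη.le (by linarith) (by positivity) (by positivity)
      have h5 : (1 : ℝ) ≤ e ^ 2 := one_le_pow₀ he1
      have h6 : ε * B ^ 2 ≤ ε * (e ^ 2 * B ^ 2) := by
        refine mul_le_mul_of_nonneg_left ?_ hε.le
        nlinarith [sq_nonneg B]
      calc 4 * Var[Q; unitLaw g] ≤ ε * B ^ 2 := by linarith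
        _ ≤ _ := h6
        _ = _ := by ring

/-! ### The oscillating statistic -/

/-- The expectation of `exp (i l X²)` for `X` of law `N(r, 1)`. -/
def squareCharFun (l r : ℝ) : ℂ :=
  ∫ x, Complex.exp (l * Complex.I * x ^ 2) ∂(gaussianReal r 1)

lemma squareCharFun_eq (l r : ℝ) :
    squareCharFun l r = (Real.sqrt (2 * Real.pi))⁻¹ *
      (Real.pi / (1 / 2 - l * Complex.I)) ^ (1 / 2 : ℂ) *
      Complex.exp (l * r ^ 2 * Complex.I / (1 - 2 * l * Complex.I)) := by
  have hne : (1 - 2 * l * Complex.I : ℂ) ≠ 0 := by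
    intro h
    have := congrArg Complex.re h
    simp at this
  have hre : ((-(1 / 2) + l * Complex.I : ℂ)).re < 0 := by simp
  rw [squareCharFun, integral_gaussianReal_eq_integral_smul one_ne_zero]
  have h1 : ∀ x : ℝ, gaussianPDFReal r 1 x • Complex.exp (l * Complex.I * x ^ 2) =
      ((Real.sqrt (2 * Real.pi))⁻¹ : ℂ) * Complex.exp ((-(1 / 2) + l * Complex.I) * x ^ 2 +
        r * x + -(r ^ 2 / 2)) := by
    intro x
    rw [gaussianPDFReal, Complex.real_smul]
    push_cast
    rw [mul_assoc, ← Complex.exp_add]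
    simp only [mul_one]
    congr 2
    ring
  simp_rw [h1]
  rw [integral_const_mul, integral_cexp_quadratic hre, mul_assoc]
  push_cast
  congr 2
  · congr 1
    ring
  · congr 1
    have h2 : (-(1 / 2) + l * Complex.I : ℂ) = -(1 - 2 * l * Complex.I) / 2 := by ring
    rw [h2]
    field_simp
    ring

lemma squareCharFun_eq_mul (l r : ℝ) :
    squareCharFun l r = squareCharFun l 0 *
      Complex.exp (l * r ^ 2 * Complex.I / (1 - 2 * l * Complex.I)) := by
  rw [squareCharFun_eq, squareCharFun_eq]
  simp

lemma exp_neg_sq_le_norm_squareCharFun (l : ℝ) :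
    Real.exp (-l ^ 2) ≤ ‖squareCharFun l 0‖ := by
  have hsq : ((Real.pi / (1 / 2 - l * Complex.I)) ^ (1 / 2 : ℂ)) ^ 2 =
      (Real.pi / (1 / 2 - l * Complex.I) : ℂ) := by
    rw [← Complex.cpow_nat_mul]
    simp
  have hn : ‖(1 / 2 - l * Complex.I : ℂ)‖ ^ 2 = 1 / 4 + l ^ 2 := by
    rw [Complex.sq_norm, Complex.normSq_apply]
    simp
    ring
  have hne : (0 : ℝ) < 1 / 4 + l ^ 2 := by positivity
  have h4 : ‖squareCharFun l 0‖ ^ 4 = 1 / (1 + 4 * l ^ 2) := by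
    have : squareCharFun l 0 ^ 2 = ((2 * Real.pi)⁻¹ : ℝ) *
        (Real.pi / (1 / 2 - l * Complex.I) : ℂ) := by
      rw [squareCharFun_eq, mul_pow, mul_pow, hsq, ← Complex.ofReal_pow,
        inv_pow, Real.sq_sqrt (by positivity)]
      simp
    rw [show 4 = 2 * 2 by rfl, pow_mul, ← norm_pow, this, norm_mul, norm_div, mul_pow, div_pow, hn,
      Complex.norm_real, Complex.norm_real, Real.norm_eq_abs, Real.norm_eq_abs, sq_abs, sq_abs]
    have := Real.pi_pos
    field_simp
    ring
  refine le_of_pow_le_pow_left₀ (n := 4) (by norm_num) (norm_nonneg _) ?_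
  rw [h4, ← Real.exp_nat_mul, le_div_iff₀ (by positivity)]
  have := Real.add_one_le_exp (4 * l ^ 2)
  calc Real.exp ((4 : ℕ) * -l ^ 2) * (1 + 4 * l ^ 2)
      ≤ Real.exp ((4 : ℕ) * -l ^ 2) * Real.exp (4 * l ^ 2) := by gcongr; linarith
    _ = 1 := by rw [← Real.exp_add]; simp

lemma integral_exp_sum_sq {d : ℕ} (l : ℝ) (g : Obs d) :
    ∫ x, Complex.exp (l * Complex.I * ((∑ i, x i ^ 2 : ℝ) : ℂ)) ∂(unitLaw g) =
      squareCharFun l 0 ^ d *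
        Complex.exp (l * ((∑ i, g i ^ 2 : ℝ) : ℂ) * Complex.I / (1 - 2 * l * Complex.I)) := by
  rw [unitLaw_eq_map_pi, integral_map (by fun_prop)
    (Measurable.aestronglyMeasurable (by fun_prop))]
  have h : ∀ x : Fin d → ℝ, Complex.exp (l * Complex.I * ((∑ i, x i ^ 2 : ℝ) : ℂ)) =
      ∏ i, Complex.exp (l * Complex.I * (x i : ℂ) ^ 2) := by
    intro x
    rw [← Complex.exp_sum, ← Finset.mul_sum]
    push_cast
    rfl
  simp only [h]
  rw [integral_fintype_prod_eq_prod (f := fun _ (x : ℝ) =>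
    Complex.exp (l * Complex.I * (x : ℂ) ^ 2))]
  have h2 : ∀ i, ∫ x, Complex.exp (l * Complex.I * (x : ℂ) ^ 2) ∂(gaussianReal (g i) 1) =
      squareCharFun l 0 * Complex.exp (l * (g i) ^ 2 * Complex.I / (1 - 2 * l * Complex.I)) :=
    fun i => squareCharFun_eq_mul l (g i)
  simp only [h2, Finset.prod_mul_distrib, Finset.prod_const, Finset.card_univ, Fintype.card_fin]
  rw [← Complex.exp_sum]
  congr 2
  rw [← Finset.sum_div, ← Finset.sum_mul, ← Finset.mul_sum]
  push_cast
  rfl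

/-- A bounded statistic whose mean grows linearly in `‖g‖²` as long as `‖g‖² ≤ s √d`. It is
`sin (l ‖x‖² - θ)` with `l = 1 / (s √d)`, the phase `θ` being such that the mean vanishes at
`g = 0`: the expectation of `exp (i l ‖x‖²)` is explicit, so that no estimate of the distribution
function of `‖x‖²` is needed. -/
lemma exists_oscillating_statistic {d : ℕ} (hd : 1 ≤ d) {s : ℝ} (hs : 1 ≤ s) :
    ∃ h : Obs d → ℝ, Measurable h ∧ (∀ x, |h x| ≤ 1) ∧ ∫ x, h x ∂(unitLaw 0) = 0 ∧
      ∀ g : Obs d, ∑ i, g i ^ 2 ≤ s * Real.sqrt d →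
        Real.exp (-3) / 10 * (∑ i, g i ^ 2) / (s * Real.sqrt d) ≤ ∫ x, h x ∂(unitLaw g) := by
  have hd1 : (1 : ℝ) ≤ d := by exact_mod_cast hd
  have hsd : 1 ≤ Real.sqrt d := Real.one_le_sqrt.2 hd1
  have hss : Real.sqrt d ^ 2 = d := Real.sq_sqrt (by positivity)
  set l : ℝ := 1 / (s * Real.sqrt d) with hl
  have hl0 : 0 < l := by positivity
  have hl1 : l ≤ 1 := by
    rw [hl, div_le_one (by positivity)]
    nlinarith
  set w : ℂ := squareCharFun l 0 ^ d with hw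
  have hwn : Real.exp (-1) ≤ ‖w‖ := by
    rw [hw, norm_pow]
    refine le_trans ?_ (pow_le_pow_left₀ (Real.exp_pos _).le
      (exp_neg_sq_le_norm_squareCharFun l) d)
    rw [← Real.exp_nat_mul, Real.exp_le_exp, hl, div_pow, mul_pow, hss]
    have : (d : ℝ) * -(1 ^ 2 / (s ^ 2 * d)) = - (1 / s ^ 2) := by field_simp
    rw [this, neg_le_neg_iff, div_le_one (by positivity)]
    exact one_le_pow₀ hs
  have hw0 : 0 < ‖w‖ := (Real.exp_pos _).trans_le hwn
  set u : ℂ := (starRingEnd ℂ) w / ‖w‖ with hu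
  have hun : ‖u‖ = 1 := by
    rw [hu, norm_div, RCLike.norm_conj, Complex.norm_real, norm_norm, div_self hw0.ne']
  have hwu : w * u = ‖w‖ := by
    have hw0' : (‖w‖ : ℂ) ≠ 0 := by exact_mod_cast hw0.ne'
    rw [hu, mul_div_assoc', Complex.mul_conj, Complex.normSq_eq_norm_sq]
    push_cast
    field_simp
  set F : Obs d → ℂ := fun x => Complex.exp (l * Complex.I * ((∑ i, x i ^ 2 : ℝ) : ℂ)) * u with hF
  have hFm : Measurable F := by fun_prop
  have hFn : ∀ x, ‖F x‖ = 1 := by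
    intro x
    rw [hF]
    simp only
    rw [norm_mul, hun, mul_one, mul_right_comm, ← Complex.ofReal_mul, Complex.norm_exp_ofReal_mul_I]
  have hFi : ∀ g, Integrable F (unitLaw g) := fun g =>
    Integrable.of_bound hFm.aestronglyMeasurable 1
      (Filter.Eventually.of_forall fun x => (hFn x).le)
  have hint : ∀ g : Obs d, ∫ x, (F x).im ∂(unitLaw g) =
      ‖w‖ * (Complex.exp (l * ((∑ i, g i ^ 2 : ℝ) : ℂ) * Complex.I /
        (1 - 2 * l * Complex.I))).im := by
    intro g
    have h1 : ∫ x, (F x).im ∂(unitLaw g) = (∫ x, F x ∂(unitLaw g)).im := integral_im (hFi g)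
    rw [h1, hF]
    simp only
    rw [integral_mul_const, integral_exp_sum_sq, mul_right_comm, hwu, Complex.im_ofReal_mul]
  refine ⟨fun x => (F x).im, Complex.measurable_im.comp hFm, fun x => ?_, ?_, fun g hg => ?_⟩
  · exact (Complex.abs_im_le_norm _).trans (hFn x).le
  · rw [hint]
    simp
  · rw [hint]
    set G := ∑ i, g i ^ 2 with hG
    have hG0 : 0 ≤ G := Finset.sum_nonneg fun i _ => sq_nonneg _
    set a := l * G / (1 + 4 * l ^ 2) with ha
    have hlG : l * G ≤ 1 := by
      rw [hl, one_div, inv_mul_le_iff₀ (by positivity), mul_one]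
      exact hg
    have ha0 : 0 ≤ a := by positivity
    have ha1 : a ≤ 1 := by
      refine (div_le_self (by positivity) ?_).trans hlG
      nlinarith [sq_nonneg l]
    have ha2 : l * G / 5 ≤ a := by
      rw [ha]
      gcongr
      nlinarith
    have hz : (l * (G : ℂ) * Complex.I / (1 - 2 * l * Complex.I)) =
        ((-(2 * l * a) : ℝ) : ℂ) + (a : ℝ) * Complex.I := by
      have hne : (1 - 2 * l * Complex.I : ℂ) ≠ 0 := by
        intro h
        have := congrArg Complex.re h
        simp at this
      have haG : (a : ℂ) * (1 + 4 * (l : ℂ) ^ 2) = l * G := by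
        have : a * (1 + 4 * l ^ 2) = l * G := div_mul_cancel₀ _ (by positivity)
        exact_mod_cast this
      rw [div_eq_iff hne]
      push_cast
      linear_combination (-Complex.I) * haG + 2 * l * a * Complex.I_sq
    rw [hz, Complex.exp_add, ← Complex.ofReal_exp, Complex.im_ofReal_mul, Complex.exp_mul_I,
      ← Complex.ofReal_cos, ← Complex.ofReal_sin]
    simp only [Complex.add_im, Complex.ofReal_im, Complex.mul_im, Complex.I_re, Complex.I_im,
      Complex.ofReal_re, mul_zero, mul_one, zero_add, add_zero]
    have hsin : a / 2 ≤ Real.sin a := by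
      have := Real.mul_le_sin ha0 (by linarith [Real.pi_gt_three])
      refine le_trans ?_ this
      rw [div_eq_inv_mul]
      gcongr
      rw [inv_eq_one_div, div_le_div_iff₀ (by norm_num) Real.pi_pos]
      linarith [Real.pi_le_four]
    have hexp : Real.exp (-2) ≤ Real.exp (-(2 * l * a)) := by
      apply Real.exp_le_exp.2
      nlinarith
    calc Real.exp (-3) / 10 * G / (s * Real.sqrt d)
        = Real.exp (-1) * (Real.exp (-2) * (l * G / 5 / 2)) := by
          rw [show (-3 : ℝ) = -1 + -2 by norm_num, Real.exp_add, hl]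
          ring
      _ ≤ ‖w‖ * (Real.exp (-(2 * l * a)) * Real.sin a) := by
          gcongr
          linarith

/-! ### The test based on one bit per machine -/

/-- With one bit per machine, `m` machines detect signals with `‖g‖² ≥ C √d / √m`. One machine
takes care of the signals with `‖g‖²` of larger order than `√d`, for which the oscillating
statistic of the other machines is of no use. -/
lemma exists_one_bit_test {ε : ℝ} (hε : 0 < ε) : ∃ C : ℝ, 0 < C ∧ ∀ m d b : ℕ,
    1 ≤ m → 1 ≤ d → 1 ≤ b → Testable (Fin m) d b (ENNReal.ofReal ε)
      {g | C * (Real.sqrt d / Real.sqrt m) ≤ ∑ i, g i ^ 2} := by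
  obtain ⟨C₁, hC₁, hloc⟩ := exists_local_test (half_pos hε)
  set s := max C₁ 1 with hs
  have hs1 : 1 ≤ s := le_max_right _ _
  have hs0 : 0 < s := by linarith
  have hsε : 0 < Real.sqrt ε := Real.sqrt_pos.2 hε
  refine ⟨s + 40 * Real.exp 3 * s / Real.sqrt ε, by positivity, fun m d b hm hd hb => ?_⟩
  have hd0 : 0 < Real.sqrt (d : ℝ) := Real.sqrt_pos.2 (by exact_mod_cast hd)
  have hm1 : (1 : ℝ) ≤ m := by exact_mod_cast hm
  have hm0 : 0 < Real.sqrt (m : ℝ) := Real.sqrt_pos.2 (by linarith)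
  have hlocal := (hloc d b hd hb).mono_error (ENNReal.ofReal_le_ofReal (half_le_self hε.le))
  have hext : 0 ≤ 40 * Real.exp 3 * s / Real.sqrt ε := by positivity
  rcases hm.eq_or_lt with rfl | hm2
  · refine hlocal.subset fun g hg => Or.inl ?_
    simp only [Set.mem_ofPred_eq, Nat.cast_one, Real.sqrt_one, div_one] at hg
    refine le_trans ?_ hg
    gcongr
    exact (le_max_left C₁ 1).trans (by linarith)
  · obtain ⟨h, hh, hh1, hh0, hhg⟩ := exists_oscillating_statistic hd hs1
    have hmany := Testable.of_bounded_mean hb (M := m - 1) (by omega) hh hh1 hh0 (half_pos hε)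
    have htest := ((hloc d b hd hb).union hmany).of_card_le (κ := Fin m) (by simp; omega)
    rw [← ENNReal.ofReal_add (half_pos hε).le (half_pos hε).le, add_halves] at htest
    refine htest.subset fun g hg => ?_
    by_cases hbig : s * Real.sqrt d ≤ ∑ i, g i ^ 2
    · refine Or.inl (Or.inl (le_trans ?_ hbig))
      gcongr
      exact le_max_left _ _
    · refine Or.inr ((le_trans ?_ (hhg g (not_le.1 hbig).le)))
      have hm' : (m : ℝ) / 2 ≤ ((m - 1 : ℕ) : ℝ) := by
        have : (m : ℝ) ≤ 2 * ((m - 1 : ℕ) : ℝ) := by exact_mod_cast (by omega)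
        linarith
      have h1 : Real.sqrt ε * Real.sqrt m / 2 ≤ Real.sqrt (ε / 2 * ((m - 1 : ℕ) : ℝ)) := by
        refine Real.le_sqrt_of_sq_le ?_
        rw [div_pow, mul_pow, Real.sq_sqrt hε.le, Real.sq_sqrt (by linarith)]
        nlinarith
      have hg' : 40 * Real.exp 3 * s / Real.sqrt ε * (Real.sqrt d / Real.sqrt m) ≤
          ∑ i, g i ^ 2 := le_trans (by gcongr; linarith) hg
      calc 2 / Real.sqrt (ε / 2 * ((m - 1 : ℕ) : ℝ))
          ≤ 2 / (Real.sqrt ε * Real.sqrt m / 2) := by gcongr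
        _ = Real.exp (-3) / 10 * (40 * Real.exp 3 * s / Real.sqrt ε *
              (Real.sqrt d / Real.sqrt m)) / (s * Real.sqrt d) := by
            rw [Real.exp_neg]
            field_simp
            norm_num
        _ ≤ _ := by gcongr

/-! ### Sign bits -/

/-- The sign bit of a real number, as `±1` (with value `-1` at `0`). -/
def realSign (x : ℝ) : ℝ := bitSign (decide (0 < x))

lemma realSign_sq (x : ℝ) : realSign x ^ 2 = 1 := bitSign_sq _

lemma abs_realSign (x : ℝ) : |realSign x| = 1 := abs_bitSign _

lemma realSign_of_pos {x : ℝ} (hx : 0 < x) : realSign x = 1 := by simp [realSign, bitSign, hx]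

lemma realSign_of_nonpos {x : ℝ} (hx : x ≤ 0) : realSign x = -1 := by
  simp [realSign, bitSign, not_lt.2 hx]

lemma measurable_realSign : Measurable realSign :=
  measurable_bitSign.comp (measurable_to_bool (by
    convert (measurableSet_Ioi : MeasurableSet (Set.Ioi (0 : ℝ))) using 1
    ext x
    simp))

lemma integrable_realSign (P : Measure ℝ) [IsProbabilityMeasure P] : Integrable realSign P :=
  Integrable.of_bound measurable_realSign.aestronglyMeasurable 1
    (Filter.Eventually.of_forall fun x => by rw [Real.norm_eq_abs]; exact (abs_realSign x).le)

/-- The mean `2 Φ(r) - 1` of the sign bit of a variable of law `N(r, 1)`. -/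
def signMean (r : ℝ) : ℝ := ∫ x, realSign x ∂(gaussianReal r 1)

/-- The symmetrised formula for the mean of a sign bit, obtained from the invariance of `N(0, 1)`
under `z ↦ -z`. -/
lemma signMean_eq (r : ℝ) :
    signMean r = ∫ z, (realSign (r + z) + realSign (r - z)) / 2 ∂(gaussianReal 0 1) := by
  have h1 : signMean r = ∫ z, realSign (r + z) ∂(gaussianReal 0 1) := by
    rw [signMean, ← zero_add r, ← gaussianReal_map_const_add, zero_add,
      integral_map (by fun_prop) measurable_realSign.aestronglyMeasurable]
  have h2 : signMean r = ∫ z, realSign (r - z) ∂(gaussianReal 0 1) := by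
    rw [signMean]
    conv_lhs => rw [← sub_zero r, ← gaussianReal_map_const_sub]
    rw [integral_map (by fun_prop) measurable_realSign.aestronglyMeasurable]
  have hi : ∀ f : ℝ → ℝ, Measurable f →
      Integrable (fun z => realSign (f z)) (gaussianReal 0 1) := fun f hf =>
    Integrable.of_bound (measurable_realSign.comp hf).aestronglyMeasurable 1
      (Filter.Eventually.of_forall fun x => by rw [Real.norm_eq_abs]; exact (abs_realSign _).le)
  rw [integral_div, integral_add (hi _ (by fun_prop)) (hi _ (by fun_prop)), ← h1, ← h2]
  ring

lemma signMean_zero : signMean 0 = 0 := by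
  have : signMean 0 = -signMean 0 := by
    have hz : ∀ᵐ z ∂(gaussianReal 0 1), realSign (0 - z) = -realSign z := by
      have h0 : gaussianReal 0 1 {(0 : ℝ)} = 0 :=
        gaussianReal_absolutelyContinuous 0 one_ne_zero Real.volume_singleton
      have : ∀ᵐ z ∂(gaussianReal 0 1), z ≠ (0 : ℝ) := by
        rw [ae_iff]
        simpa using h0
      filter_upwards [this] with z hz
      rcases lt_or_gt_of_ne hz with h | h
      · rw [realSign_of_pos (by linarith), realSign_of_nonpos h.le, neg_neg]
      · rw [realSign_of_nonpos (by linarith), realSign_of_pos h]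
    have h2 : ∫ z, realSign (0 - z) ∂(gaussianReal 0 1) = signMean 0 := by
      rw [signMean]
      conv_rhs => rw [← sub_zero (0 : ℝ), ← gaussianReal_map_const_sub]
      rw [integral_map (by fun_prop) measurable_realSign.aestronglyMeasurable]
    calc signMean 0 = ∫ z, -realSign z ∂(gaussianReal 0 1) := by
          rw [← h2, integral_congr_ae hz]
      _ = -signMean 0 := integral_neg _
  linarith

lemma gaussianReal_Ioo_ge {s : ℝ} (hs0 : 0 ≤ s) (hs1 : s ≤ 1) :
    s / 4 ≤ (gaussianReal 0 1).real (Set.Ioo (-s) s) := by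
  rw [measureReal_def, gaussianReal_apply_eq_integral 0 one_ne_zero, ENNReal.toReal_ofReal
    (integral_nonneg fun x => gaussianPDFReal_nonneg _ _ _)]
  have hpdf : ∀ x ∈ Set.Ioo (-s) s, (1 / 8 : ℝ) ≤ gaussianPDFReal 0 1 x := by
    intro x hx
    rw [gaussianPDFReal]
    simp only [NNReal.coe_one, mul_one, sub_zero]
    have hx2 : x ^ 2 ≤ 1 := by nlinarith [hx.1, hx.2]
    have h1 : Real.sqrt (2 * Real.pi) ≤ 3 := by
      rw [Real.sqrt_le_left (by norm_num)]
      linarith [Real.pi_le_four]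
    have h2 : (1 / 2 : ℝ) ≤ Real.exp (-x ^ 2 / 2) := by
      have := Real.add_one_le_exp (-x ^ 2 / 2)
      linarith
    have h3 : (1 / 3 : ℝ) ≤ (Real.sqrt (2 * Real.pi))⁻¹ := by
      rw [one_div]
      exact inv_anti₀ (Real.sqrt_pos.2 (by positivity)) h1
    calc (1 / 8 : ℝ) ≤ 1 / 3 * (1 / 2) := by norm_num
      _ ≤ _ := by gcongr
  have h := setIntegral_mono_on (μ := volume) (f := fun _ => (1 / 8 : ℝ)) (s := Set.Ioo (-s) s)
    (by simp) (integrable_gaussianPDFReal 0 1).integrableOn measurableSet_Ioo hpdf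
  refine le_trans (le_of_eq ?_) h
  rw [setIntegral_const, measureReal_def, Real.volume_Ioo, ENNReal.toReal_ofReal (by linarith)]
  simp
  ring

/-- The information carried by a sign bit is of the order of the squared signal, up to a constant
level at which it saturates. -/
lemma min_sq_one_le_signMean_sq (r : ℝ) : min (r ^ 2) 1 / 16 ≤ signMean r ^ 2 := by
  have key : min |r| 1 / 4 ≤ |signMean r| := by
    have hmin0 : 0 ≤ min |r| 1 := le_min (abs_nonneg _) zero_le_one
    have hI := gaussianReal_Ioo_ge hmin0 (min_le_right |r| 1)
    set I := Set.Ioo (-min |r| 1) (min |r| 1) with hIdef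
    have hm : (gaussianReal 0 1).real I ≤ |signMean r| := by
      have hint : Integrable (fun z => (realSign (r + z) + realSign (r - z)) / 2)
          (gaussianReal 0 1) := by
        refine Integrable.of_bound (by
          have := measurable_realSign
          fun_prop) 1 (Filter.Eventually.of_forall fun z => ?_)
        rw [Real.norm_eq_abs, abs_div, abs_two, div_le_one (by norm_num)]
        refine (abs_add_le _ _).trans ?_
        rw [abs_realSign, abs_realSign]
        norm_num
      have hind : ∫ z, I.indicator (1 : ℝ → ℝ) z ∂(gaussianReal 0 1) =
          (gaussianReal 0 1).real I := integral_indicator_one measurableSet_Ioo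
      have hii : Integrable (I.indicator (1 : ℝ → ℝ)) (gaussianReal 0 1) :=
        (integrable_const (1 : ℝ)).indicator measurableSet_Ioo
      rw [← hind]
      rcases le_or_gt r 0 with hr | hr
      · refine le_trans ?_ (neg_le_abs _)
        rw [signMean_eq, ← integral_neg]
        refine integral_mono hii hint.neg fun z => ?_
        by_cases hz : z ∈ I
        · have h1 : z < -r := hz.2.trans_le ((min_le_left _ _).trans (abs_of_nonpos hr).le)
          have h2 : r < z := by
            have := hz.1
            have h3 := (min_le_left |r| 1).trans (abs_of_nonpos hr).le
            linarith
          simp only [hz, Set.indicator_of_mem, Pi.one_apply]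
          rw [realSign_of_nonpos (by linarith), realSign_of_nonpos (by linarith)]
          norm_num
        · simp only [hz, not_false_eq_true, Set.indicator_of_notMem]
          rcases le_total 0 z with h | h
          · rw [realSign_of_nonpos (x := r - z) (by linarith)]
            have := abs_le.1 (abs_realSign (r + z)).le
            linarith [this.2]
          · rw [realSign_of_nonpos (x := r + z) (by linarith)]
            have := abs_le.1 (abs_realSign (r - z)).le
            linarith [this.2]
      · refine le_trans ?_ (le_abs_self _)
        rw [signMean_eq]
        refine integral_mono hii hint fun z => ?_
        by_cases hz : z ∈ I
        · have h1 : z < r := hz.2.trans_le ((min_le_left _ _).trans (abs_of_pos hr).le)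
          have h2 : -r < z := by
            have := hz.1
            have h3 := (min_le_left |r| 1).trans (abs_of_pos hr).le
            linarith
          simp only [hz, Set.indicator_of_mem, Pi.one_apply]
          rw [realSign_of_pos (by linarith), realSign_of_pos (by linarith)]
          norm_num
        · simp only [hz, not_false_eq_true, Set.indicator_of_notMem]
          rcases le_total 0 z with h | h
          · rw [realSign_of_pos (x := r + z) (by linarith)]
            have := abs_le.1 (abs_realSign (r - z)).le
            linarith [this.1]
          · rw [realSign_of_pos (x := r - z) (by linarith)]
            have := abs_le.1 (abs_realSign (r + z)).le
            linarith [this.1]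
    exact hI.trans hm
  have h1 : min (r ^ 2) 1 = min |r| 1 ^ 2 := by
    rcases le_total |r| 1 with h | h
    · rw [min_eq_left h, sq_abs, min_eq_left]
      exact (sq_le_one_iff_abs_le_one r).2 h
    · rw [min_eq_right h, min_eq_right, one_pow]
      exact (one_le_sq_iff_one_le_abs r).2 h
  have h2 := pow_le_pow_left₀ (by positivity) key 2
  rw [sq_abs] at h2
  rw [h1]
  refine le_trans (le_of_eq ?_) h2
  ring

/-! ### Products of sums of sign bits -/

section SignSums

variable {r k : ℕ}

/-- The product over `r` groups of the sum of the `k` sign bits of the group. -/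
def signProduct (x : Fin r × Fin k → ℝ) : ℝ := ∏ a, ∑ j, realSign (x (a, j))

lemma measurable_signProduct : Measurable (signProduct (r := r) (k := k)) := by
  unfold signProduct
  have := measurable_realSign
  fun_prop

lemma abs_signProduct_le (x : Fin r × Fin k → ℝ) : |signProduct x| ≤ (k : ℝ) ^ r := by
  rw [signProduct, Finset.abs_prod]
  refine (Finset.prod_le_prod (fun _ _ => abs_nonneg _) fun a _ =>
    (Finset.abs_sum_le_sum_abs _ _).trans_eq ?_).trans_eq (b := ∏ _a : Fin r, (k : ℝ)) ?_
  · simp [abs_realSign]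
  · simp

lemma memLp_signProduct (P : Measure (Fin r × Fin k → ℝ)) [IsProbabilityMeasure P] :
    MemLp signProduct 2 P :=
  MemLp.of_bound measurable_signProduct.aestronglyMeasurable _
    (Filter.Eventually.of_forall fun x => by rw [Real.norm_eq_abs]; exact abs_signProduct_le x)

lemma memLp_realSign (P : Measure ℝ) [IsProbabilityMeasure P] : MemLp realSign 2 P :=
  MemLp.of_bound measurable_realSign.aestronglyMeasurable 1
    (Filter.Eventually.of_forall fun x => by rw [Real.norm_eq_abs]; exact (abs_realSign x).le)

lemma integral_sum_realSign (c : ℝ) :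
    ∫ x, ∑ j : Fin k, realSign (x j) ∂(Measure.pi fun _ : Fin k => gaussianReal c 1) =
      k * signMean c := by
  rw [integral_finsetSum]
  · have : ∀ j : Fin k, ∫ x : Fin k → ℝ, realSign (x j)
        ∂(Measure.pi fun _ : Fin k => gaussianReal c 1) = signMean c := fun j =>
      integral_comp_eval (μ := fun _ : Fin k => gaussianReal c 1) (f := realSign)
        measurable_realSign.aestronglyMeasurable
    simp [this]
  · intro j _
    exact integrable_comp_eval (μ := fun _ : Fin k => gaussianReal c 1) (f := realSign)
      (integrable_realSign _)

lemma integral_sum_realSign_sq_le (c : ℝ) :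
    ∫ x, (∑ j : Fin k, realSign (x j)) ^ 2 ∂(Measure.pi fun _ : Fin k => gaussianReal c 1) ≤
      k + (k * signMean c) ^ 2 := by
  set P := Measure.pi fun _ : Fin k => gaussianReal c 1 with hP
  have hm : MemLp (∑ j, fun x : Fin k → ℝ => realSign (x j)) 2 P :=
    memLp_finsetSum' _ fun j _ => (memLp_realSign _).comp_measurePreserving
      (measurePreserving_eval (fun _ : Fin k => gaussianReal c 1) j)
  have hv : Var[∑ j, fun x : Fin k → ℝ => realSign (x j); P] ≤ k := by
    rw [hP, variance_sum_pi (X := fun _ => realSign) fun _ => memLp_realSign _]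
    refine (Finset.sum_le_card_nsmul _ _ 1 fun j _ => ?_).trans (by simp)
    refine (variance_le_expectation_sq measurable_realSign.aestronglyMeasurable).trans ?_
    simp [realSign_sq]
  rw [variance_eq_sub hm] at hv
  simp only [Pi.pow_apply, Finset.sum_apply] at hv
  rw [integral_sum_realSign] at hv
  linarith

lemma integral_signProduct (c : ℝ) :
    ∫ x, signProduct x ∂(Measure.pi fun _ : Fin r × Fin k => gaussianReal c 1) =
      (k * signMean c) ^ r := by
  have hm : Measurable fun x : Fin r → Fin k → ℝ => ∏ a, ∑ j, realSign (x a j) := by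
    have := measurable_realSign
    fun_prop
  have h := integral_map (μ := Measure.pi fun _ : Fin r × Fin k => gaussianReal c 1)
    (φ := fun x a j => x (a, j)) (Measurable.aemeasurable (by fun_prop)) hm.aestronglyMeasurable
  rw [pi_map_curry (fun _ _ => gaussianReal c 1), integral_fintype_prod_eq_prod
    (f := fun _ (x : Fin k → ℝ) => ∑ j, realSign (x j))] at h
  simp only [integral_sum_realSign, Finset.prod_const, Finset.card_univ, Fintype.card_fin] at h
  exact h.symm

lemma integral_signProduct_sq_le (c : ℝ) :
    ∫ x, signProduct x ^ 2 ∂(Measure.pi fun _ : Fin r × Fin k => gaussianReal c 1) ≤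
      (k + (k * signMean c) ^ 2) ^ r := by
  have hm : Measurable fun x : Fin r → Fin k → ℝ => ∏ a, (∑ j, realSign (x a j)) ^ 2 := by
    have := measurable_realSign
    fun_prop
  have h := integral_map (μ := Measure.pi fun _ : Fin r × Fin k => gaussianReal c 1)
    (φ := fun x a j => x (a, j)) (Measurable.aemeasurable (by fun_prop)) hm.aestronglyMeasurable
  rw [pi_map_curry (fun _ _ => gaussianReal c 1), integral_fintype_prod_eq_prod
    (f := fun _ (x : Fin k → ℝ) => (∑ j, realSign (x j)) ^ 2)] at h
  simp only [Finset.prod_const, Finset.card_univ, Fintype.card_fin] at h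
  simp only [signProduct, ← Finset.prod_pow]
  rw [← h]
  exact pow_le_pow_left₀ (integral_nonneg fun x => sq_nonneg _) (integral_sum_realSign_sq_le c) r

/-- With the signal strength `x = k μ²`, the variance of a product of `r` sums is at most
`k ^ r ((1 + x) ^ r - x ^ r)`. -/
lemma variance_signProduct_le (c : ℝ) :
    Var[signProduct; Measure.pi fun _ : Fin r × Fin k => gaussianReal c 1] ≤
      k ^ r * ((1 + k * signMean c ^ 2) ^ r - (k * signMean c ^ 2) ^ r) := by
  rw [variance_eq_sub (memLp_signProduct _), integral_signProduct]
  have h := integral_signProduct_sq_le (r := r) (k := k) c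
  simp only [Pi.pow_apply]
  refine (sub_le_sub_right h _).trans (le_of_eq ?_)
  rw [mul_sub, ← mul_pow, ← mul_pow, ← pow_mul, mul_comm r 2, pow_mul]
  congr 2 <;> ring

end SignSums

/-- A binomial expansion with a small coefficient for the leading term. -/
lemma exists_one_add_pow_sub_pow_le (r : ℕ) {δ : ℝ} (hδ : 0 < δ) :
    ∃ K : ℝ, 1 ≤ K ∧ ∀ x : ℝ, 0 ≤ x → (1 + x) ^ r - x ^ r ≤ K + δ * x ^ r := by
  obtain ⟨y, hy0, hy⟩ : ∃ y : ℝ, 0 < y ∧ (1 + y) ^ r < 1 + δ := by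
    have hc : ContinuousAt (fun y : ℝ => (1 + y) ^ r) 0 := by fun_prop
    have h0 : (fun y : ℝ => (1 + y) ^ r) 0 < 1 + δ := by simpa using hδ
    have := (hc.eventually_lt_const h0).filter_mono (nhdsWithin_le_nhds (s := Set.Ioi 0))
    obtain ⟨y, hy, hy0⟩ := (this.and self_mem_nhdsWithin).exists
    exact ⟨y, hy0, hy⟩
  refine ⟨(1 + 1 / y) ^ r, one_le_pow₀ (by simp [hy0.le]), fun x hx => ?_⟩
  rcases le_total x (1 / y) with h | h
  · have h1 : (1 + x) ^ r ≤ (1 + 1 / y) ^ r := by gcongr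
    have h2 : 0 ≤ x ^ r := by positivity
    nlinarith
  · have hxy : 1 ≤ x * y := by rwa [div_le_iff₀ hy0] at h
    have h1 : (1 + x) ^ r ≤ (x * (1 + y)) ^ r := pow_le_pow_left₀ (by positivity) (by linarith) r
    rw [mul_pow] at h1
    have h2 : x ^ r * (1 + y) ^ r ≤ x ^ r * (1 + δ) := by gcongr
    have h3 : 0 ≤ (1 + 1 / y) ^ r := by positivity
    linarith

/-! ### The test based on sign bits -/

section SignTest

variable {r k D d b : ℕ}

/-- The bits sent by the machine `(a, j, t)`: the signs of the coordinates of the block `t`, each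
coordinate `i` being stored at position `(e i).2` of the block `(e i).1`. Unused positions contain
`false`. -/
def signBits (e : Fin d → Fin D × Fin b) (p : Fin r × Fin k × Fin D) (x : Obs d) (s : Fin b) :
    Bool :=
  decide (∃ i, e i = (p.2.2, s) ∧ 0 < x i)

lemma measurable_signBits (e : Fin d → Fin D × Fin b) (p : Fin r × Fin k × Fin D) :
    Measurable (signBits e p) := by
  refine measurable_pi_lambda _ fun s => measurable_to_bool ?_
  have : MeasurableSet (⋃ i, {x : Obs d | e i = (p.2.2, s) ∧ 0 < x i}) := by
    refine MeasurableSet.iUnion fun i => ?_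
    by_cases h : e i = (p.2.2, s)
    · simp only [h, true_and]
      exact measurableSet_lt measurable_const (by fun_prop)
    · simp [h]
  convert this using 1
  ext x
  simp [signBits]

lemma bitSign_signBits {e : Fin d → Fin D × Fin b} (he : Function.Injective e) (a : Fin r)
    (j : Fin k) (x : Obs d) (i : Fin d) :
    bitSign (signBits e (a, j, (e i).1) x (e i).2) = realSign (x i) := by
  have : (∃ i', e i' = ((e i).1, (e i).2) ∧ 0 < x i') ↔ 0 < x i := by
    constructor
    · rintro ⟨i', h, h'⟩
      rwa [he h] at h'
    · exact fun h => ⟨i, rfl, h⟩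
  simp only [signBits, realSign, this]

/-- The law of the observations that are relevant for the coordinate `i`, jointly in `i`: they are
independent, since distinct coordinates of one machine are. -/
lemma pi_unitLaw_map_coordinates {e : Fin d → Fin D × Fin b} (g : Obs d) :
    (Measure.pi fun _ : Fin r × Fin k × Fin D => unitLaw g).map
      (fun x i (q : Fin r × Fin k) => x (q.1, q.2, (e i).1) i) =
    Measure.pi fun i => Measure.pi fun _ : Fin r × Fin k => gaussianReal (g i) 1 := by
  have h1 : (unitLaw g).map WithLp.ofLp = Measure.pi fun i => gaussianReal (g i) 1 := by
    rw [unitLaw_eq_map_pi, Measure.map_map (by fun_prop) (by fun_prop)]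
    exact Measure.map_id
  have hp : IsProbabilityMeasure ((unitLaw g).map WithLp.ofLp) := by rw [h1]; infer_instance
  have h2 : (Measure.pi fun _ : Fin r × Fin k × Fin D => unitLaw g).map
      (fun x (p : (Fin r × Fin k × Fin D) × Fin d) => x p.1 p.2) =
      Measure.pi fun p : (Fin r × Fin k × Fin D) × Fin d => gaussianReal (g p.2) 1 := by
    rw [← pi_pi_map_uncurry (fun (_ : Fin r × Fin k × Fin D) i => gaussianReal (g i) 1), ← h1,
      ← Measure.pi_map_pi (fun _ => by fun_prop), Measure.map_map (by fun_prop) (by fun_prop)]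
    rfl
  set f : Fin d × (Fin r × Fin k) → (Fin r × Fin k × Fin D) × Fin d :=
    fun p => ((p.2.1, p.2.2, (e p.1).1), p.1) with hf
  have hfi : Function.Injective f := by
    rintro ⟨i, a, j⟩ ⟨i', a', j'⟩ h
    simp only [hf, Prod.mk.injEq] at h ⊢
    exact ⟨h.2, h.1.1, h.1.2.1⟩
  rw [← pi_map_curry (fun i (_ : Fin r × Fin k) => gaussianReal (g i) 1)]
  have h3 := pi_map_comp_injective
    (fun p : (Fin r × Fin k × Fin D) × Fin d => gaussianReal (g p.2) 1) hfi
  simp only [hf] at h3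
  rw [← h3, ← h2, Measure.map_map (by fun_prop) (by fun_prop),
    Measure.map_map (by fun_prop) (by fun_prop)]
  rfl

/-- `k` groups of `D` machines communicate, `2 q` times, the signs of all `d` coordinates. For each
coordinate the `2 q` sums of `k` signs are multiplied; summing these products over the coordinates
gives a centred statistic under the null hypothesis, and detects signals for which
`∑ i, min (g i ^ 2) 1 ^ q` is at least of the order `√d / k ^ q`. -/
lemma exists_sign_test {q : ℕ} (hq : q ≠ 0) {ε : ℝ} (hε : 0 < ε) : ∃ C : ℝ, 0 < C ∧
    ∀ d b D k : ℕ, 1 ≤ d → 1 ≤ k → d ≤ D * b →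
      Testable (Fin (2 * q) × Fin k × Fin D) d b (ENNReal.ofReal ε)
        {g | C * Real.sqrt d ≤ (k : ℝ) ^ q * ∑ i, min (g i ^ 2) 1 ^ q} := by
  obtain ⟨K, hK1, hK⟩ := exists_one_add_pow_sub_pow_le (2 * q) (δ := ε / 8) (by positivity)
  have hK0 : 0 < K := by linarith
  set c := Real.sqrt (8 * K / ε) with hc
  have hc0 : 0 < c := Real.sqrt_pos.2 (by positivity)
  have hcc : c ^ 2 = 8 * K / ε := Real.sq_sqrt (by positivity)
  refine ⟨16 ^ q * c, by positivity, fun d b D k hd hk hdb => ?_⟩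
  have hd0 : (0 : ℝ) < d := by exact_mod_cast hd
  have hk0 : (0 : ℝ) < k := by exact_mod_cast hk
  set s := Real.sqrt d with hs
  have hs0 : 0 < s := Real.sqrt_pos.2 hd0
  have hss : s ^ 2 = d := Real.sq_sqrt hd0.le
  obtain ⟨e, he⟩ : ∃ e : Fin d → Fin D × Fin b, Function.Injective e := by
    obtain ⟨e⟩ := Function.Embedding.nonempty_of_card_le (α := Fin d) (β := Fin D × Fin b)
      (by simpa using hdb)
    exact ⟨e, e.injective⟩
  set Q : (Fin d → Fin (2 * q) × Fin k → ℝ) → ℝ := fun x => ∑ i, signProduct (x i) with hQ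
  have hQm : Measurable Q := Finset.measurable_fun_sum _ fun i _ =>
    measurable_signProduct.comp (measurable_pi_apply i)
  set P : Obs d → Measure (Fin d → Fin (2 * q) × Fin k → ℝ) := fun g =>
    Measure.pi fun i => Measure.pi fun _ => gaussianReal (g i) 1 with hP
  have hQ2 : ∀ g, MemLp Q 2 (P g) := fun g =>
    memLp_finsetSum _ fun i _ => (memLp_signProduct _).comp_measurePreserving
      (measurePreserving_eval
        (fun i => Measure.pi fun _ : Fin (2 * q) × Fin k => gaussianReal (g i) 1) i)
  -- the signal strength, in units of the noise
  set A : Obs d → ℝ := fun g => ∑ i, (k * signMean (g i) ^ 2) ^ q with hA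
  have hA0 : ∀ g, 0 ≤ A g := fun g => Finset.sum_nonneg fun i _ => by positivity
  have hmean : ∀ g, ∫ x, Q x ∂(P g) = k ^ q * A g := by
    intro g
    simp only [hQ, hP, hA]
    rw [integral_finsetSum, Finset.mul_sum]
    · refine Finset.sum_congr rfl fun i _ => ?_
      have := integral_comp_eval
        (μ := fun i => Measure.pi fun _ : Fin (2 * q) × Fin k => gaussianReal (g i) 1)
        (f := signProduct) (i := i) measurable_signProduct.aestronglyMeasurable
      rw [this, integral_signProduct, pow_mul, ← mul_pow]
      congr 1
      ring
    · intro i _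
      exact integrable_comp_eval
        (μ := fun i => Measure.pi fun _ : Fin (2 * q) × Fin k => gaussianReal (g i) 1)
        (f := signProduct) ((memLp_signProduct _).integrable (by norm_num))
  have hvar : ∀ g, Var[Q; P g] ≤ (k ^ q) ^ 2 * (K * d + ε / 8 * A g ^ 2) := by
    intro g
    have : Q = ∑ i, fun x : Fin d → Fin (2 * q) × Fin k → ℝ => signProduct (x i) := by
      ext x; simp [hQ]
    rw [this, variance_sum_pi (X := fun _ => signProduct) fun _ => memLp_signProduct _]
    calc ∑ i, Var[signProduct; Measure.pi fun _ : Fin (2 * q) × Fin k => gaussianReal (g i) 1]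
        ≤ ∑ i, (k ^ q : ℝ) ^ 2 * (K + ε / 8 * ((k * signMean (g i) ^ 2) ^ q) ^ 2) := by
          refine Finset.sum_le_sum fun i _ => (variance_signProduct_le _).trans ?_
          rw [← pow_mul, ← pow_mul, mul_comm q 2]
          gcongr
          exact hK _ (by positivity)
      _ = (k ^ q) ^ 2 * (K * d + ε / 8 * ∑ i, ((k * signMean (g i) ^ 2) ^ q) ^ 2) := by
          rw [← Finset.mul_sum, Finset.sum_add_distrib, ← Finset.mul_sum]
          simp [mul_comm]
      _ ≤ _ := by
          gcongr
          exact Finset.sum_sq_le_sq_sum_of_nonneg fun i _ => by positivity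
  set t := (k : ℝ) ^ q * (s * c / 2) with ht
  have ht0 : 0 < t := by positivity
  set φ : ((Fin (2 * q) × Fin k × Fin D) → Obs d) → Fin d → Fin (2 * q) × Fin k → ℝ :=
    fun x i p => x (p.1, p.2, (e i).1) i with hφ
  have hφm : Measurable φ := by fun_prop
  have hlaw : ∀ g, (Measure.pi fun _ : Fin (2 * q) × Fin k × Fin D => unitLaw g).map φ = P g :=
    fun g => pi_unitLaw_map_coordinates g
  -- the rejection region only depends on the bits
  set R : Set ((Fin (2 * q) × Fin k × Fin D) → Fin b → Bool) :=
    {y | 0 + t ≤ ∑ i, ∏ a, ∑ j, bitSign (y (a, j, (e i).1) (e i).2)} with hR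
  have hRQ : ∀ x, (fun p => signBits e p (x p)) ∈ R ↔ 0 + t ≤ Q (φ x) := by
    intro x
    simp only [hR, Set.mem_ofPred_eq, bitSign_signBits he]
    rfl
  have hMQ : MeasurableSet {x | 0 + t ≤ Q x} := measurableSet_le measurable_const hQm
  have hMQ' : MeasurableSet {x | ¬ (0 + t ≤ Q x)} := hMQ.compl
  have htt : t ^ 2 = (k ^ q) ^ 2 * (2 * K * d / ε) := by
    rw [ht, mul_pow, div_pow, mul_pow, hss, hcc]
    ring
  refine Testable.of_measurable (φ := fun p => signBits e p) (measurable_signBits e) R ?_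
    fun g hg => ?_
  · simp only [hRQ]
    have hA00 : A 0 = 0 := by simp [hA, signMean_zero, hq]
    have h := measure_add_le_le_of_variance_le (m₀ := 0) (ε := ε) (hQ2 0) ht0
      (by rw [hmean, hA00, mul_zero]) ?_
    · rw [← hlaw, Measure.map_apply hφm hMQ] at h
      exact h
    · refine (hvar 0).trans ?_
      rw [hA00, htt, mul_left_comm]
      gcongr
      rw [mul_div_cancel₀ _ hε.ne']
      nlinarith
  · simp only [hRQ]
    have hAg : c * s ≤ A g := by
      have h1 : (k : ℝ) ^ q * ∑ i, min (g i ^ 2) 1 ^ q ≤ 16 ^ q * A g := by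
        rw [Finset.mul_sum, Finset.mul_sum]
        refine Finset.sum_le_sum fun i _ => ?_
        rw [← mul_pow, ← mul_pow]
        have h2 := min_sq_one_le_signMean_sq (g i)
        refine pow_le_pow_left₀ (by positivity) ?_ q
        calc k * min (g i ^ 2) 1 ≤ k * (16 * signMean (g i) ^ 2) := by gcongr; linarith
          _ = _ := by ring
      have h2 : 16 ^ q * (c * s) ≤ 16 ^ q * A g := by
        rw [← mul_assoc]
        exact le_trans hg h1
      exact le_of_mul_le_mul_left h2 (by positivity)
    have h := measure_not_add_le_le_of_variance_le (P := P g) (Q := Q) (m₀ := 0) (t := t) (ε := ε)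
      (hQ2 g) ht0 ?_ ?_
    · rw [← hlaw, Measure.map_apply hφm hMQ'] at h
      exact h
    · rw [hmean, ht]
      calc 0 + 2 * ((k : ℝ) ^ q * (s * c / 2)) = k ^ q * (c * s) := by ring
        _ ≤ _ := by gcongr
    · rw [hmean, sub_zero]
      have h2 : 8 * K * d ≤ ε * A g ^ 2 := by
        have h3 := pow_le_pow_left₀ (by positivity) hAg 2
        rw [mul_pow, hcc, hss, div_mul_eq_mul_div, div_le_iff₀ hε] at h3
        linarith
      calc 4 * Var[Q; P g] ≤ 4 * ((k ^ q) ^ 2 * (K * d + ε / 8 * A g ^ 2)) := by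
            gcongr
            exact hvar g
        _ = (k ^ q) ^ 2 * (4 * K * d + ε / 2 * A g ^ 2) := by ring
        _ ≤ (k ^ q) ^ 2 * (ε * A g ^ 2) := by gcongr; linarith
        _ = _ := by ring

end SignTest

/-! ### The test based on many bits -/

/-- The sign tests with `q = 1` and `q = 2` and the local test together see the whole norm: the
coordinates with `|g i| ≤ 1` contribute to the norm at most the first term, and those with
`|g i| > 1` at most the second one, by the Cauchy–Schwarz inequality. -/
lemma sum_sq_le_of_truncated {d : ℕ} (g : Obs d) :
    ∑ i, g i ^ 2 ≤ ∑ i, min (g i ^ 2) 1 ^ 1 +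
      Real.sqrt ((∑ i, min (g i ^ 2) 1 ^ 2) * ∑ i, g i ^ 4) := by
  have h1 : ∑ i, g i ^ 2 ≤ ∑ i, min (g i ^ 2) 1 ^ 1 + ∑ i, min (g i ^ 2) 1 * g i ^ 2 := by
    rw [← Finset.sum_add_distrib]
    refine Finset.sum_le_sum fun i _ => ?_
    rcases le_total (g i ^ 2) 1 with h | h
    · rw [min_eq_left h]
      nlinarith [sq_nonneg (g i)]
    · rw [min_eq_right h]
      linarith
  refine h1.trans (add_le_add le_rfl (Real.le_sqrt_of_sq_le ?_))
  refine (Finset.sum_mul_sq_le_sq_mul_sq _ _ _).trans (le_of_eq ?_)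
  congr 1
  refine Finset.sum_congr rfl fun i _ => ?_
  ring

/-- If `D` machines together have enough bits for all coordinates, then `m ≥ 7 D` machines detect
signals with `‖g‖² ≥ C √d D / m`. -/
lemma exists_many_bits_test {ε : ℝ} (hε : 0 < ε) : ∃ C : ℝ, 0 < C ∧ ∀ m d b D : ℕ,
    1 ≤ d → 1 ≤ b → 1 ≤ D → d ≤ D * b → 7 * D ≤ m →
      Testable (Fin m) d b (ENNReal.ofReal ε) {g | C * (Real.sqrt d * D / m) ≤ ∑ i, g i ^ 2} := by
  obtain ⟨C₁, hC₁, h₁⟩ := exists_sign_test one_ne_zero (show 0 < ε / 3 by positivity)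
  obtain ⟨C₂, hC₂, h₂⟩ := exists_sign_test two_ne_zero (show 0 < ε / 3 by positivity)
  obtain ⟨C₃, hC₃, h₃⟩ := exists_local_test (show 0 < ε / 3 by positivity)
  have hr0 : 0 ≤ Real.sqrt (C₂ * C₃) := Real.sqrt_nonneg _
  refine ⟨12 * (C₁ + Real.sqrt (C₂ * C₃)), by positivity, fun m d b D hd hb hD hdb hm => ?_⟩
  set k := (m - 1) / (6 * D) with hk
  have hk1 : 1 ≤ k := (Nat.one_le_div_iff (by omega)).2 (by omega)
  have hkm : 6 * D * k ≤ m - 1 := Nat.mul_div_le _ _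
  have hmk : m ≤ 12 * (D * k) := by
    have h := Nat.lt_mul_div_succ (m - 1) (show 0 < 6 * D by omega)
    rw [← hk, mul_add, mul_one, mul_assoc] at h
    have : D ≤ D * k := Nat.le_mul_of_pos_right _ hk1
    omega
  have htest := ((h₃ d b hd hb).union ((h₁ d b D k hd hk1 hdb).union
    (h₂ d b D k hd hk1 hdb))).of_card_le (κ := Fin m) (by
      simp only [Fintype.card_sum, Fintype.card_prod, Fintype.card_fin]
      have : 6 * D * k = 2 * 1 * (k * D) + 2 * 2 * (k * D) := by ring
      omega)
  rw [← ENNReal.ofReal_add (by positivity) (by positivity),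
    ← ENNReal.ofReal_add (by positivity) (by positivity),
    show ε / 3 + (ε / 3 + ε / 3) = ε by ring] at htest
  refine htest.subset fun g hg => ?_
  by_contra hcon
  simp only [Set.mem_union, Set.mem_ofPred_eq, not_or, not_le] at hcon
  obtain ⟨⟨-, hc3⟩, hc1, hc2⟩ := hcon
  rw [pow_one] at hc1
  have hk0 : (0 : ℝ) < k := by exact_mod_cast hk1
  have hm0 : (0 : ℝ) < m := by exact_mod_cast (by omega : 0 < m)
  have hs0 : 0 < Real.sqrt (d : ℝ) := Real.sqrt_pos.2 (by exact_mod_cast hd)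
  set s := Real.sqrt (d : ℝ)
  have hb1 : ∑ i, min (g i ^ 2) 1 ^ 1 < C₁ * s / k := by
    rw [lt_div_iff₀ hk0, mul_comm]; exact hc1
  have hb2 : ∑ i, min (g i ^ 2) 1 ^ 2 ≤ C₂ * s / k ^ 2 := by
    rw [le_div_iff₀ (by positivity), mul_comm]; exact hc2.le
  have hsqrt : Real.sqrt ((∑ i, min (g i ^ 2) 1 ^ 2) * ∑ i, g i ^ 4) ≤
      Real.sqrt (C₂ * C₃) * (s / k) := by
    rw [← Real.sqrt_sq (show 0 ≤ s / k by positivity), ← Real.sqrt_mul (by positivity)]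
    refine Real.sqrt_le_sqrt ?_
    calc (∑ i, min (g i ^ 2) 1 ^ 2) * ∑ i, g i ^ 4 ≤ C₂ * s / k ^ 2 * (C₃ * s) :=
          mul_le_mul hb2 hc3.le (Finset.sum_nonneg fun i _ => by positivity) (by positivity)
      _ = _ := by ring
  have hlt : ∑ i, g i ^ 2 < (C₁ + Real.sqrt (C₂ * C₃)) * (s / k) := by
    calc ∑ i, g i ^ 2 ≤ _ := sum_sq_le_of_truncated g
      _ < C₁ * s / k + Real.sqrt (C₂ * C₃) * (s / k) := add_lt_add_of_lt_of_le hb1 hsqrt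
      _ = _ := by ring
  have hsk : s / k ≤ 12 * (s * D / m) := by
    rw [← mul_div_assoc, div_le_div_iff₀ hk0 hm0]
    have : (m : ℝ) ≤ 12 * (D * k) := by exact_mod_cast hmk
    calc s * m ≤ s * (12 * (D * k)) := by gcongr
      _ = _ := by ring
  have hfin : (C₁ + Real.sqrt (C₂ * C₃)) * (s / k) ≤ ∑ i, g i ^ 2 := by
    refine le_trans ?_ hg
    calc (C₁ + Real.sqrt (C₂ * C₃)) * (s / k)
        ≤ (C₁ + Real.sqrt (C₂ * C₃)) * (12 * (s * D / m)) := by gcongr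
      _ = _ := by ring
  linarith

/-! ### Random projections -/

section Projection

variable {d e : ℕ} (c : Fin d → Fin e)

/-- The norm of the part of `w` with indices in the block `c ⁻¹ β`. -/
def blockNorm (w : Obs d) (β : Fin e) : ℝ := Real.sqrt (∑ i, if c i = β then w i ^ 2 else 0)

/-- The projection of `x` on the directions of the parts of `w` in the blocks of coordinates given
by `c`. Distinct blocks being disjoint, these directions are orthonormal as soon as no part
of `w` vanishes. -/
def blockProjection (x w : Obs d) : Obs e :=
  WithLp.toLp 2 fun β => (∑ i, if c i = β then w i * x i else 0) / blockNorm c w β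

lemma blockProjection_apply (x w : Obs d) (β : Fin e) :
    blockProjection c x w β = (∑ i, if c i = β then w i * x i else 0) / blockNorm c w β := rfl

lemma blockNorm_sq (w : Obs d) (β : Fin e) :
    blockNorm c w β ^ 2 = ∑ i, if c i = β then w i ^ 2 else 0 :=
  Real.sq_sqrt (Finset.sum_nonneg fun i _ => by split_ifs <;> positivity)

lemma measurable_blockNorm (β : Fin e) : Measurable fun w => blockNorm c w β := by
  unfold blockNorm
  refine Measurable.sqrt (Finset.measurable_fun_sum _ fun i _ => ?_)
  split_ifs <;> fun_prop

lemma measurable_blockProjection : Measurable (Function.uncurry (blockProjection c)) := by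
  refine (WithLp.measurable_toLp 2 _).comp (measurable_pi_lambda _ fun β => ?_)
  refine Measurable.div (Finset.measurable_fun_sum _ fun i _ => ?_)
    ((measurable_blockNorm c β).comp measurable_snd)
  split_ifs <;> fun_prop

lemma blockProjection_zero (w : Obs d) : blockProjection c 0 w = 0 := by
  ext β
  simp [blockProjection_apply]

lemma blockProjection_add (x y w : Obs d) :
    blockProjection c (x + y) w = blockProjection c x w + blockProjection c y w := by
  ext β
  simp only [blockProjection_apply, PiLp.add_apply]
  rw [← add_div, ← Finset.sum_add_distrib]
  congr 1
  refine Finset.sum_congr rfl fun i _ => ?_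
  split_ifs <;> ring

/-- Projecting on orthonormal directions maps the standard normal law to the standard normal
law. -/
lemma stdGaussian_map_blockProjection {w : Obs d} (hw : ∀ β, blockNorm c w β ≠ 0) :
    (stdGaussian (Obs d)).map (fun x => blockProjection c x w) = stdGaussian (Obs e) := by
  have hm : Measurable fun x => blockProjection c x w :=
    (measurable_blockProjection c).comp measurable_prodMk_right
  have hp : IsProbabilityMeasure ((stdGaussian (Obs d)).map fun x => blockProjection c x w) :=
    Measure.isProbabilityMeasure_map hm.aemeasurable
  refine Measure.ext_of_charFun ?_
  ext t
  set t' : Obs d := WithLp.toLp 2 fun i => t (c i) * w i / blockNorm c w (c i) with ht'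
  have hinner : ∀ x, inner ℝ (blockProjection c x w) t = inner ℝ x t' := by
    intro x
    simp only [PiLp.inner_apply, RCLike.inner_apply, conj_trivial, blockProjection_apply, ht']
    simp only [Finset.sum_div, Finset.mul_sum]
    rw [Finset.sum_comm]
    refine Finset.sum_congr rfl fun i _ => ?_
    rw [Finset.sum_eq_single (c i)]
    · simp only [if_true]; ring
    · intro β _ hβ
      simp [hβ.symm]
    · simp
  have hnorm : ‖t'‖ ^ 2 = ‖t‖ ^ 2 := by
    rw [EuclideanSpace.real_norm_sq_eq, EuclideanSpace.real_norm_sq_eq]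
    have h1 : ∀ i, t' i ^ 2 =
        ∑ β, if c i = β then t β ^ 2 / blockNorm c w β ^ 2 * w i ^ 2 else 0 := by
      intro i
      rw [Finset.sum_ite_eq]
      simp only [ht', Finset.mem_univ, if_true]
      ring
    simp only [h1]
    rw [Finset.sum_comm]
    refine Finset.sum_congr rfl fun β _ => ?_
    have h2 : ∀ i, (if c i = β then t β ^ 2 / blockNorm c w β ^ 2 * w i ^ 2 else 0) =
        t β ^ 2 / blockNorm c w β ^ 2 * (if c i = β then w i ^ 2 else 0) := fun i => by
      split_ifs <;> ring
    simp only [h2]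
    rw [← Finset.mul_sum, ← blockNorm_sq, div_mul_cancel₀ _ (pow_ne_zero 2 (hw β))]
  rw [charFun_apply, integral_map hm.aemeasurable (by fun_prop)]
  simp only [hinner]
  rw [← charFun_apply, charFun_stdGaussian, charFun_stdGaussian]
  have h3 : (‖t'‖ : ℂ) ^ 2 = (‖t‖ : ℂ) ^ 2 := by exact_mod_cast hnorm
  rw [h3]

lemma unitLaw_map_blockProjection {w : Obs d} (hw : ∀ β, blockNorm c w β ≠ 0) (g : Obs d) :
    (unitLaw g).map (fun x => blockProjection c x w) = unitLaw (blockProjection c g w) := by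
  have hm : Measurable fun x => blockProjection c x w :=
    (measurable_blockProjection c).comp measurable_prodMk_right
  rw [unitLaw, unitLaw, ← stdGaussian_map_blockProjection c hw,
    Measure.map_map hm (by fun_prop), Measure.map_map (by fun_prop) hm]
  congr 1
  ext1 z
  exact blockProjection_add c g z w

lemma gaussianReal_Ioo_le {s : ℝ} (hs : 0 ≤ s) :
    gaussianReal 0 1 (Set.Ioo (-s) s) ≤ ENNReal.ofReal s := by
  rw [gaussianReal_apply_eq_integral 0 one_ne_zero]
  refine ENNReal.ofReal_le_ofReal ?_
  have hpdf : ∀ x ∈ Set.Ioo (-s) s, gaussianPDFReal 0 1 x ≤ 1 / 2 := by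
    intro x _
    rw [gaussianPDFReal]
    simp only [NNReal.coe_one, mul_one, sub_zero]
    have h1 : 2 ≤ Real.sqrt (2 * Real.pi) := by
      refine Real.le_sqrt_of_sq_le ?_
      linarith [Real.pi_gt_three]
    have h2 : Real.exp (-x ^ 2 / 2) ≤ 1 := Real.exp_le_one_iff.2 (by nlinarith [sq_nonneg x])
    have h3 : (Real.sqrt (2 * Real.pi))⁻¹ ≤ 1 / 2 := by
      rw [one_div]
      exact inv_anti₀ (by norm_num) h1
    calc _ ≤ 1 / 2 * (1 : ℝ) := by gcongr
      _ = _ := by norm_num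
  have h := setIntegral_mono_on (μ := volume) (g := fun _ => (1 / 2 : ℝ)) (s := Set.Ioo (-s) s)
    (integrable_gaussianPDFReal 0 1).integrableOn (by simp) measurableSet_Ioo hpdf
  refine h.trans (le_of_eq ?_)
  rw [setIntegral_const, measureReal_def, Real.volume_Ioo, ENNReal.toReal_ofReal (by linarith)]
  simp
  ring

/-- Small ball estimate for a linear functional of a standard normal vector. -/
lemma stdGaussian_abs_inner_lt_le (v : Obs d) {η : ℝ} (hη : 0 ≤ η) :
    stdGaussian (Obs d) {w | |inner ℝ v w| < η * ‖v‖} ≤ ENNReal.ofReal η := by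
  rcases eq_or_ne v 0 with rfl | hv
  · simp
  have hv0 : 0 < ‖v‖ := norm_pos_iff.2 hv
  set u : Obs d := (1 / ‖v‖) • v with hu
  have hun : ‖u‖ = 1 := by
    rw [hu, norm_smul, norm_div, norm_one, norm_norm, one_div, inv_mul_cancel₀ hv0.ne']
  have hmap : (stdGaussian (Obs d)).map (innerSL ℝ u) = gaussianReal 0 1 := by
    rw [IsGaussian.map_eq_gaussianReal, variance_dual_stdGaussian, innerSL_apply_norm, hun]
    have := integral_strongDual_stdGaussian (E := Obs d) (innerSL ℝ u)
    rw [this]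
    simp
  have hset : {w | |inner ℝ v w| < η * ‖v‖} = innerSL ℝ u ⁻¹' Set.Ioo (-η) η := by
    ext w
    simp only [Set.mem_ofPred_eq, Set.mem_preimage, Set.mem_Ioo, ← abs_lt]
    rw [innerSL_apply_apply, hu, inner_smul_left, abs_mul]
    simp only [conj_trivial, abs_div, abs_one, abs_norm]
    rw [one_div, inv_mul_lt_iff₀ hv0, mul_comm η]
  rw [hset, ← Measure.map_apply (by fun_prop) measurableSet_Ioo, hmap]
  exact gaussianReal_Ioo_le hη

lemma integrable_sq_stdGaussian (i : Fin d) :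
    Integrable (fun w : Obs d => w i ^ 2) (stdGaussian (Obs d)) := by
  rw [← map_pi_eq_stdGaussian, integrable_map_measure (by fun_prop) (by fun_prop)]
  exact integrable_comp_eval (μ := fun _ : Fin d => gaussianReal 0 1) (f := fun x => x ^ 2)
    (memLp_id_gaussianReal 2).integrable_sq

lemma integral_sq_stdGaussian (i : Fin d) :
    ∫ w : Obs d, w i ^ 2 ∂(stdGaussian (Obs d)) = 1 := by
  rw [← map_pi_eq_stdGaussian, integral_map (by fun_prop) (by fun_prop)]
  have h := integral_comp_eval (μ := fun _ : Fin d => gaussianReal 0 1) (f := fun x => x ^ 2)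
    (i := i) (by fun_prop)
  have hv := variance_fun_id_gaussianReal (μ := 0) (v := 1)
  rw [variance_of_integral_eq_zero (by fun_prop) integral_id_gaussianReal] at hv
  exact h.trans (by simpa using hv)

lemma blockNorm_ne_zero_ae (hc : Function.Surjective c) :
    ∀ᵐ w ∂(stdGaussian (Obs d)), ∀ β, blockNorm c w β ≠ 0 := by
  rw [ae_all_iff]
  intro β
  obtain ⟨i, hi⟩ := hc β
  have h0 : ∀ᵐ w ∂(stdGaussian (Obs d)), w i ≠ 0 := by
    have hz : gaussianReal 0 1 {(0 : ℝ)} = 0 :=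
      gaussianReal_absolutelyContinuous 0 one_ne_zero Real.volume_singleton
    rw [ae_iff, ← map_pi_eq_stdGaussian, Measure.map_apply (by fun_prop)
      (by simpa using measurableSet_eq_fun (by fun_prop) measurable_const)]
    simp only [not_not]
    exact ((measurePreserving_eval (fun _ : Fin d => gaussianReal 0 1) i).measure_preimage
      (measurableSet_singleton (0 : ℝ)).nullMeasurableSet).trans hz
  filter_upwards [h0] with w hw h
  have h1 := blockNorm_sq c w β
  rw [h, zero_pow two_ne_zero, eq_comm,
    Finset.sum_eq_zero_iff_of_nonneg fun i _ => by split_ifs <;> positivity] at h1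
  have h2 := h1 i (Finset.mem_univ i)
  rw [if_pos hi] at h2
  exact hw (pow_eq_zero_iff two_ne_zero |>.1 h2)

/-- The energy of `g` in a block. -/
def blockEnergy (g : Obs d) (β : Fin e) : ℝ := ∑ i, if c i = β then g i ^ 2 else 0

lemma blockEnergy_nonneg (g : Obs d) (β : Fin e) : 0 ≤ blockEnergy c g β :=
  Finset.sum_nonneg fun i _ => by split_ifs <;> positivity

lemma sum_blockEnergy (g : Obs d) : ∑ β, blockEnergy c g β = ∑ i, g i ^ 2 := by
  unfold blockEnergy
  rw [Finset.sum_comm]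
  simp

/-- Within one block of at most `L` coordinates, the projection keeps a fraction of the order
`1 / L` of the energy, except with small probability. -/
lemma stdGaussian_blockProjection_sq_lt_le (g : Obs d) (β : Fin e) {L η : ℝ} (hL : 0 < L)
    (hcard : (Finset.univ.filter fun i => c i = β).card ≤ L) (hη : 0 < η) :
    (stdGaussian (Obs d)).real
      {w | blockProjection c g w β ^ 2 < η ^ 3 / L * blockEnergy c g β} ≤ 2 * η := by
  set γ := stdGaussian (Obs d)
  set v : Obs d := WithLp.toLp 2 fun i => if c i = β then g i else 0 with hv
  have hvn : ‖v‖ ^ 2 = blockEnergy c g β := by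
    rw [EuclideanSpace.real_norm_sq_eq]
    refine Finset.sum_congr rfl fun i _ => ?_
    simp only [hv]
    split_ifs <;> simp
  have hvi : ∀ w : Obs d, inner ℝ v w = ∑ i, if c i = β then w i * g i else 0 := by
    intro w
    rw [PiLp.inner_apply]
    refine Finset.sum_congr rfl fun i _ => ?_
    simp only [hv, RCLike.inner_apply, conj_trivial]
    split_ifs <;> simp
  have hnint : Integrable (fun w => blockNorm c w β ^ 2) γ := by
    simp only [blockNorm_sq]
    refine integrable_finsetSum _ fun i _ => ?_
    split_ifs
    · exact integrable_sq_stdGaussian i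
    · exact integrable_zero _ _ _
  have hnmean : ∫ w, blockNorm c w β ^ 2 ∂γ ≤ L := by
    simp only [blockNorm_sq]
    rw [integral_finsetSum]
    · refine (le_of_eq ?_).trans hcard
      have : ∀ i, ∫ w : Obs d, (if c i = β then w i ^ 2 else 0) ∂γ = if c i = β then 1 else 0 := by
        intro i
        split_ifs
        · exact integral_sq_stdGaussian i
        · simp
      simp only [this]
      simp
    · intro i _
      split_ifs
      · exact integrable_sq_stdGaussian i
      · exact integrable_zero _ _ _
  have hbig : γ.real {w | L / η ≤ blockNorm c w β ^ 2} ≤ η := by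
    have h := mul_meas_ge_le_integral_of_nonneg
      (Filter.Eventually.of_forall fun w => sq_nonneg (blockNorm c w β)) hnint (L / η)
    have h2 := h.trans hnmean
    rw [div_mul_eq_mul_div, div_le_iff₀ hη] at h2
    exact le_of_mul_le_mul_left h2 hL
  have hsmall : γ.real {w | |inner ℝ v w| < η * ‖v‖} ≤ η :=
    ENNReal.toReal_le_of_le_ofReal hη.le (stdGaussian_abs_inner_lt_le v hη.le)
  have hsub : {w | blockProjection c g w β ^ 2 < η ^ 3 / L * blockEnergy c g β} ⊆
      {w | L / η ≤ blockNorm c w β ^ 2} ∪ {w | |inner ℝ v w| < η * ‖v‖} := by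
    intro w hw
    by_contra hcon
    simp only [Set.mem_union, Set.mem_ofPred_eq, not_or, not_le, not_lt] at hcon hw
    obtain ⟨h1, h2⟩ := hcon
    rw [blockProjection_apply, ← hvi, div_pow] at hw
    have h3 : η ^ 2 * blockEnergy c g β ≤ inner ℝ v w ^ 2 := by
      have := pow_le_pow_left₀ (by positivity) h2 2
      rwa [sq_abs, mul_pow, hvn] at this
    rcases (sq_nonneg (blockNorm c w β)).eq_or_lt with h0 | h0
    · -- a vanishing part of `w` has inner product zero with everything
      have hw0 : ∀ i, c i = β → w i = 0 := by
        intro i hi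
        have h4 := blockNorm_sq c w β
        rw [← h0, eq_comm,
          Finset.sum_eq_zero_iff_of_nonneg fun i _ => by split_ifs <;> positivity] at h4
        have h5 := h4 i (Finset.mem_univ i)
        rw [if_pos hi] at h5
        exact pow_eq_zero_iff two_ne_zero |>.1 h5
      have hin : inner ℝ v w = 0 := by
        rw [hvi]
        refine Finset.sum_eq_zero fun i _ => ?_
        split_ifs with hi
        · rw [hw0 i hi, zero_mul]
        · rfl
      rw [hin, zero_pow two_ne_zero] at h3
      have h6 : blockEnergy c g β = 0 := by
        have := blockEnergy_nonneg c g β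
        have h7 : 0 < η ^ 2 := by positivity
        nlinarith
      rw [h6, hin] at hw
      simp at hw
    · rw [div_lt_iff₀ h0] at hw
      have hE := blockEnergy_nonneg c g β
      have h4 : η ^ 3 / L * blockEnergy c g β * blockNorm c w β ^ 2 ≤
          η ^ 3 / L * blockEnergy c g β * (L / η) := by gcongr
      have h5 : η ^ 3 / L * blockEnergy c g β * (L / η) = η ^ 2 * blockEnergy c g β := by
        field_simp
      linarith
  calc γ.real _ ≤ γ.real ({w | L / η ≤ blockNorm c w β ^ 2} ∪ {w | |inner ℝ v w| < η * ‖v‖}) :=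
        measureReal_mono hsub
    _ ≤ η + η := (measureReal_union_le _ _).trans (add_le_add hbig hsmall)
    _ = 2 * η := by ring

/-- The random projection keeps a fraction of the order `1 / L` of the energy, except with small
probability. The blocks where it fails carry at most half of the energy by Markov's inequality, so
that no independence between blocks is needed. -/
lemma stdGaussian_sum_blockProjection_sq_lt_le (g : Obs d) {L η : ℝ} (hL : 0 < L)
    (hcard : ∀ β, ((Finset.univ.filter fun i => c i = β).card : ℝ) ≤ L) (hη : 0 < η) :
    stdGaussian (Obs d)
      {w | ∑ β, blockProjection c g w β ^ 2 < η ^ 3 / (2 * L) * ∑ i, g i ^ 2} ≤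
        ENNReal.ofReal (4 * η) := by
  set γ := stdGaussian (Obs d)
  set G := ∑ i, g i ^ 2 with hG
  have hG0 : 0 ≤ G := Finset.sum_nonneg fun i _ => sq_nonneg _
  rcases hG0.eq_or_lt with h0 | hGpos
  · have : {w | ∑ β, blockProjection c g w β ^ 2 < η ^ 3 / (2 * L) * G} = ∅ := by
      ext w
      simp only [← h0, mul_zero, Set.mem_ofPred_eq, Set.mem_empty_iff_false, iff_false, not_lt]
      exact Finset.sum_nonneg fun β _ => sq_nonneg _
    rw [this]
    simp
  set B : Fin e → Set (Obs d) := fun β =>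
    {w | blockProjection c g w β ^ 2 < η ^ 3 / L * blockEnergy c g β} with hB
  have hBm : ∀ β, MeasurableSet (B β) := by
    intro β
    have hm : Measurable fun w => blockProjection c g w β :=
      (by fun_prop : Measurable fun x : Obs e => x β).comp
        ((measurable_blockProjection c).comp measurable_prodMk_left)
    exact measurableSet_lt (hm.pow_const 2) measurable_const
  -- the energy of the blocks where the projection fails
  set W : Obs d → ℝ := fun w => ∑ β, blockEnergy c g β * (B β).indicator 1 w with hW
  have hWβ : ∀ β, Integrable (fun w => blockEnergy c g β * (B β).indicator 1 w) γ := fun β =>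
    ((integrable_const (1 : ℝ)).indicator (hBm β)).const_mul _
  have hW0 : ∀ w, 0 ≤ W w := fun w => Finset.sum_nonneg fun β _ =>
    mul_nonneg (blockEnergy_nonneg c g β) (Set.indicator_nonneg (fun _ _ => zero_le_one) _)
  have hWint : ∫ w, W w ∂γ ≤ 2 * η * G := by
    simp only [hW]
    rw [integral_finsetSum _ fun β _ => hWβ β, hG, ← sum_blockEnergy c, Finset.mul_sum]
    refine Finset.sum_le_sum fun β _ => ?_
    rw [integral_const_mul, integral_indicator_one (hBm β), mul_comm]
    exact mul_le_mul_of_nonneg_right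
      (stdGaussian_blockProjection_sq_lt_le c g β hL (hcard β) hη) (blockEnergy_nonneg c g β)
  have hmarkov : γ.real {w | G / 2 ≤ W w} ≤ 4 * η := by
    have h := (mul_meas_ge_le_integral_of_nonneg (Filter.Eventually.of_forall hW0)
      (integrable_finsetSum _ fun β _ => hWβ β) (G / 2)).trans hWint
    have h2 : G / 2 * γ.real {w | G / 2 ≤ W w} ≤ G / 2 * (4 * η) := h.trans (le_of_eq (by ring))
    exact le_of_mul_le_mul_left h2 (by positivity)
  have hsub : {w | ∑ β, blockProjection c g w β ^ 2 < η ^ 3 / (2 * L) * G} ⊆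
      {w | G / 2 ≤ W w} := by
    intro w hw
    simp only [Set.mem_ofPred_eq] at hw ⊢
    by_contra hcon
    rw [not_le] at hcon
    have h1 : η ^ 3 / L * (G - W w) ≤ ∑ β, blockProjection c g w β ^ 2 := by
      rw [hG, ← sum_blockEnergy c, hW, ← Finset.sum_sub_distrib, Finset.mul_sum]
      refine Finset.sum_le_sum fun β _ => ?_
      by_cases hβ : w ∈ B β
      · simp only [hβ, Set.indicator_of_mem, Pi.one_apply, mul_one, sub_self, mul_zero]
        exact sq_nonneg _
      · simp only [hβ, not_false_eq_true, Set.indicator_of_notMem, mul_zero, sub_zero]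
        exact not_lt.1 hβ
    have h2 : η ^ 3 / L * (G / 2) ≤ η ^ 3 / L * (G - W w) := by
      gcongr
      linarith
    have h3 : η ^ 3 / L * (G / 2) = η ^ 3 / (2 * L) * G := by
      field_simp
    linarith
  refine (measure_mono hsub).trans ?_
  rw [← ENNReal.ofReal_toReal (measure_ne_top γ {w | G / 2 ≤ W w})]
  exact ENNReal.ofReal_le_ofReal hmarkov

end Projection

/-! ### The two protocols -/

lemma le_sum_sq_noiseScale_smul {n m d : ℕ} (hn : 1 ≤ n) (hm : 1 ≤ m) {C t ρ : ℝ} (hρ : 0 < ρ)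
    (h : C * (Real.sqrt d / n) * t ≤ ρ ^ 2) {f : Obs d} (hf : ρ ≤ ‖f‖) :
    C * (Real.sqrt d / m) * t ≤ ∑ i, (noiseScale n m • f) i ^ 2 := by
  have hn0 : (0 : ℝ) < n := by exact_mod_cast hn
  have hm0 : (0 : ℝ) < m := by exact_mod_cast hm
  have h1 : ∑ i, (noiseScale n m • f) i ^ 2 = n / m * ‖f‖ ^ 2 := by
    rw [← EuclideanSpace.real_norm_sq_eq, norm_smul, mul_pow, Real.norm_eq_abs, sq_abs, noiseScale,
      Real.sq_sqrt (by positivity)]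
  rw [h1]
  calc C * (Real.sqrt d / m) * t = n / m * (C * (Real.sqrt d / n) * t) := by field_simp
    _ ≤ n / m * ρ ^ 2 := by gcongr
    _ ≤ n / m * ‖f‖ ^ 2 := by gcongr

lemma exists_private_protocol {α : ℝ} (hα : 0 < α) : ∃ C : ℝ, 0 < C ∧ ∀ n m d b : ℕ,
    1 ≤ n → 1 ≤ m → 1 ≤ d → 1 ≤ b → ∀ ρ : ℝ, 0 < ρ →
      C * (Real.sqrt d / n) * min ((d : ℝ) / min (b : ℝ) d) (Real.sqrt m) ≤ ρ ^ 2 →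
        ∃ P : PrivateCoinProtocol m d b, P.risk n ρ ≤ ENNReal.ofReal α := by
  obtain ⟨C₁, hC₁, h₁⟩ := exists_one_bit_test (half_pos hα)
  obtain ⟨C₂, hC₂, h₂⟩ := exists_many_bits_test (half_pos hα)
  refine ⟨14 * C₁ + 2 * C₂, by positivity, fun n m d b hn hm hd hb ρ hρ h => ?_⟩
  have hm1 : (1 : ℝ) ≤ m := by exact_mod_cast hm
  have hd0 : 0 < Real.sqrt (d : ℝ) := Real.sqrt_pos.2 (by exact_mod_cast hd)
  have hsm : 0 < Real.sqrt (m : ℝ) := Real.sqrt_pos.2 (by linarith)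
  have hsm2 : Real.sqrt m * Real.sqrt m = m := Real.mul_self_sqrt (by linarith)
  have hsm1 : 1 ≤ Real.sqrt (m : ℝ) := Real.one_le_sqrt.2 hm1
  set b' := min b d with hb'
  have hb'1 : 1 ≤ b' := le_min hb hd
  have hb'0 : (0 : ℝ) < b' := by exact_mod_cast hb'1
  have hcast : min (b : ℝ) (d : ℝ) = (b' : ℝ) := by rw [hb', Nat.cast_min]
  rw [hcast] at h
  -- the number of machines which together have one bit for each coordinate
  set D := d / b' + 1 with hD
  have hDd : (D : ℝ) ≤ 2 * (d / b') := by
    have h1 : ((d / b' : ℕ) : ℝ) ≤ d / b' := Nat.cast_div_le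
    have h2 : (1 : ℝ) ≤ d / b' := by
      rw [le_div_iff₀ hb'0, one_mul]
      exact_mod_cast min_le_right b d
    rw [hD]
    push_cast
    linarith
  have hdD : d ≤ D * b := by
    calc d ≤ D * b' := (Nat.lt_div_mul_add (a := d) hb'1 |>.trans_eq (by rw [hD]; ring)).le
      _ ≤ D * b := Nat.mul_le_mul_left _ (min_le_left _ _)
  have hfin : ∀ S : Set (Obs d), Testable (Fin m) d b (ENNReal.ofReal (α / 2)) S →
      (∀ g : Obs d, (14 * C₁ + 2 * C₂) * (Real.sqrt d / m) * min ((d : ℝ) / b') (Real.sqrt m) ≤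
        ∑ i, g i ^ 2 → g ∈ S) →
      ∃ P : PrivateCoinProtocol m d b, P.risk n ρ ≤ ENNReal.ofReal α := by
    intro S hS hsub
    obtain ⟨P, hP⟩ := hS.exists_private hn hm (ρ := ρ) fun f hf =>
      hsub _ (le_sum_sq_noiseScale_smul hn hm hρ h hf)
    refine ⟨P, hP.trans (le_of_eq ?_)⟩
    rw [← ENNReal.ofReal_add (half_pos hα).le (half_pos hα).le, add_halves]
  by_cases hcase : 7 * D ≤ m ∧ (d : ℝ) / b' ≤ Real.sqrt m
  · refine hfin _ (h₂ m d b D hd hb (Nat.le_add_left 1 _) hdD hcase.1) fun g hg => le_trans ?_ hg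
    rw [min_eq_left hcase.2]
    calc C₂ * (Real.sqrt d * D / m) ≤ C₂ * (Real.sqrt d * (2 * (d / b')) / m) := by gcongr
      _ = 2 * C₂ * (Real.sqrt d / m) * (d / b') := by ring
      _ ≤ _ := by gcongr; linarith
  · refine hfin _ (h₁ m d b hm hd hb) fun g hg => le_trans ?_ hg
    have hmin : Real.sqrt m / 14 ≤ min ((d : ℝ) / b') (Real.sqrt m) := by
      refine le_min ?_ (by linarith)
      rw [not_and_or, not_le, not_le] at hcase
      rcases hcase with hc | hc
      · have : (m : ℝ) < 7 * D := by exact_mod_cast hc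
        nlinarith
      · linarith
    calc C₁ * (Real.sqrt d / Real.sqrt m)
        = 14 * C₁ * (Real.sqrt d / m) * (Real.sqrt m / 14) := by
          field_simp
          rw [sq, hsm2]
      _ ≤ _ := by gcongr; linarith

/-- A projection on `b ∧ d` random orthonormal directions, known to all machines, reduces the
problem to one in which each machine has a bit for every coordinate. -/
lemma exists_public_protocol {α : ℝ} (hα : 0 < α) : ∃ C : ℝ, 0 < C ∧ ∀ n m d b : ℕ,
    1 ≤ n → 1 ≤ m → 1 ≤ d → 1 ≤ b → ∀ ρ : ℝ, 0 < ρ →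
      C * (Real.sqrt d / n) * min (Real.sqrt ((d : ℝ) / min (b : ℝ) d)) (Real.sqrt m) ≤ ρ ^ 2 →
        ∃ P : PublicCoinProtocol m d b, P.risk n ρ ≤ ENNReal.ofReal α := by
  have hα3 : 0 < α / 3 := by positivity
  obtain ⟨C₁, hC₁, h₁⟩ := exists_one_bit_test hα3
  obtain ⟨C₂, hC₂, h₂⟩ := exists_many_bits_test hα3
  set η := α / 12 with hη
  have hη0 : 0 < η := by positivity
  refine ⟨7 * C₁ + 4 * C₂ / η ^ 3, by positivity, fun n m d b hn hm hd hb ρ hρ h => ?_⟩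
  have hext : 0 < 4 * C₂ / η ^ 3 := by positivity
  have hm1 : (1 : ℝ) ≤ m := by exact_mod_cast hm
  have hm0 : (0 : ℝ) < m := by linarith
  have hd0 : (0 : ℝ) < d := by exact_mod_cast hd
  have hsd : 0 < Real.sqrt (d : ℝ) := Real.sqrt_pos.2 hd0
  have hsm : 0 < Real.sqrt (m : ℝ) := Real.sqrt_pos.2 hm0
  have hsm2 : Real.sqrt m * Real.sqrt m = m := Real.mul_self_sqrt (by linarith)
  have hsm1 : 1 ≤ Real.sqrt (m : ℝ) := Real.one_le_sqrt.2 hm1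
  set b' := min b d with hb'
  have hb'1 : 1 ≤ b' := le_min hb hd
  have hb'0 : (0 : ℝ) < b' := by exact_mod_cast hb'1
  have hcast : min (b : ℝ) (d : ℝ) = (b' : ℝ) := by rw [hb', Nat.cast_min]
  rw [hcast] at h
  have hdb : (1 : ℝ) ≤ d / b' := by
    rw [le_div_iff₀ hb'0, one_mul]
    exact_mod_cast min_le_right b d
  have hsum : ENNReal.ofReal (α / 3) + (ENNReal.ofReal (α / 3) + ENNReal.ofReal (α / 3)) =
      ENNReal.ofReal α := by
    rw [← ENNReal.ofReal_add hα3.le hα3.le, ← ENNReal.ofReal_add hα3.le (by positivity)]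
    congr 1
    ring
  by_cases hcase : 7 ≤ m ∧ Real.sqrt ((d : ℝ) / b') ≤ Real.sqrt m
  · rw [min_eq_left hcase.2] at h
    set c : Fin d → Fin b' := fun i => ⟨i % b', Nat.mod_lt _ hb'1⟩ with hc
    have hcs : Function.Surjective c := fun β =>
      ⟨⟨β, β.2.trans_le (min_le_right b d)⟩, Fin.ext (Nat.mod_eq_of_lt β.2)⟩
    have hcard : ∀ β, ((Finset.univ.filter fun i => c i = β).card : ℝ) ≤ 2 * (d / b') := by
      intro β
      have h1 : (Finset.univ.filter fun i => c i = β).card ≤ d / b' + 1 := by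
        refine (Finset.card_le_card_of_injOn (t := Finset.range (d / b' + 1))
          (fun i : Fin d => (i : ℕ) / b') ?_ ?_).trans_eq (Finset.card_range _)
        · intro i _
          simp only [Finset.coe_range, Set.mem_Iio]
          exact Nat.lt_succ_of_le (Nat.div_le_div_right i.2.le)
        · intro i hi j hj hij
          simp only [Finset.coe_filter, Finset.mem_univ, true_and, Set.mem_ofPred_eq] at hi hj
          have hmod : (i : ℕ) % b' = j % b' := congrArg Fin.val (hi.trans hj.symm)
          have hij' : (i : ℕ) / b' = j / b' := hij
          refine Fin.ext ?_
          rw [← Nat.div_add_mod (i : ℕ) b', ← Nat.div_add_mod (j : ℕ) b', hmod, hij']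
      have h2 : ((d / b' : ℕ) : ℝ) ≤ d / b' := Nat.cast_div_le
      have h3 : ((Finset.univ.filter fun i => c i = β).card : ℝ) ≤ ((d / b' : ℕ) : ℝ) + 1 := by
        exact_mod_cast h1
      linarith
    have htest := h₂ m b' b 1 hb'1 hb le_rfl (by rw [one_mul]; exact min_le_left _ _)
      (by omega)
    obtain ⟨P, hP⟩ := htest.exists_public (n := n) hn hm (ρ := ρ) (δ := ENNReal.ofReal (4 * η))
      (stdGaussian (Obs d)) (blockProjection c) (measurable_blockProjection c)
      (blockProjection_zero c) (fun g => by
        filter_upwards [blockNorm_ne_zero_ae c hcs] with w hw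
        exact unitLaw_map_blockProjection c hw g) (fun f hf => by
        refine (measure_mono ?_).trans (stdGaussian_sum_blockProjection_sq_lt_le c
          (noiseScale n m • f) (L := 2 * (d / b')) (by positivity) hcard hη0)
        intro w hw
        simp only [Set.mem_ofPred_eq, not_le, Nat.cast_one, mul_one] at hw ⊢
        refine hw.trans_le ?_
        have hsum' := le_sum_sq_noiseScale_smul hn hm hρ h hf
        have hsq : Real.sqrt d * Real.sqrt ((d : ℝ) / b') = d / b' * Real.sqrt b' := by
          rw [Real.sqrt_div hd0.le, ← mul_div_assoc, Real.mul_self_sqrt hd0.le,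
            div_mul_eq_mul_div, div_eq_div_iff (Real.sqrt_pos.2 hb'0).ne' hb'0.ne', mul_assoc,
            Real.mul_self_sqrt hb'0.le]
        calc C₂ * (Real.sqrt b' / m)
            = η ^ 3 / (2 * (2 * (d / b'))) *
                (4 * C₂ / η ^ 3 * (d / b' * Real.sqrt b') / m) := by
              field_simp
              norm_num
          _ = η ^ 3 / (2 * (2 * (d / b'))) *
                (4 * C₂ / η ^ 3 * (Real.sqrt d / m) * Real.sqrt ((d : ℝ) / b')) := by
              rw [← hsq]; ring
          _ ≤ η ^ 3 / (2 * (2 * (d / b'))) *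
                ((7 * C₁ + 4 * C₂ / η ^ 3) * (Real.sqrt d / m) * Real.sqrt ((d : ℝ) / b')) := by
              gcongr
              linarith
          _ ≤ _ := by gcongr)
    refine ⟨P, hP.trans (le_of_eq ?_)⟩
    rw [show 4 * η = α / 3 by rw [hη]; ring, hsum]
  · have hmin : Real.sqrt m / 7 ≤ min (Real.sqrt ((d : ℝ) / b')) (Real.sqrt m) := by
      refine le_min ?_ (by linarith)
      have h1 : 1 ≤ Real.sqrt ((d : ℝ) / b') := Real.one_le_sqrt.2 hdb
      rw [not_and_or, not_le, not_le] at hcase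
      rcases hcase with hc | hc
      · have : (m : ℝ) < 7 := by exact_mod_cast hc
        nlinarith
      · linarith
    obtain ⟨P, hP⟩ := (h₁ m d b hm hd hb).exists_public (n := n) hn hm (ρ := ρ)
      (δ := ENNReal.ofReal (α / 3)) (Measure.dirac ()) (fun x _ => x) measurable_fst
      (fun _ => rfl) (fun g => Filter.Eventually.of_forall fun _ => Measure.map_id) (fun f hf => by
        have hmem : C₁ * (Real.sqrt d / Real.sqrt m) ≤ ∑ i, (noiseScale n m • f) i ^ 2 := by
          refine le_trans ?_ (le_sum_sq_noiseScale_smul hn hm hρ h hf)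
          calc C₁ * (Real.sqrt d / Real.sqrt m)
              = 7 * C₁ * (Real.sqrt d / m) * (Real.sqrt m / 7) := by
                field_simp
                rw [sq, hsm2]
            _ ≤ _ := by gcongr; linarith
        simp only [Set.mem_ofPred_eq, hmem, not_true_eq_false]
        simp)
    exact ⟨P, hP.trans_eq hsum⟩

end DistributedTesting

end

theorem theorem2 (α : ℝ) (hα0 : 0 < α) (hα1 : α < 1) :
    ∃ C : ℝ, 0 < C ∧
      ∀ n m d b : ℕ, 1 ≤ n → 1 ≤ m → 1 ≤ d → 1 ≤ b → ∀ ρ : ℝ, 0 < ρ →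
        (C * (Real.sqrt (d : ℝ) / (n : ℝ)) *
              min (Real.sqrt ((d : ℝ) / min (b : ℝ) (d : ℝ))) (Real.sqrt (m : ℝ)) ≤ ρ ^ 2 →
          ∃ P : DistributedTesting.PublicCoinProtocol m d b,
            P.risk n ρ ≤ ENNReal.ofReal α) ∧
        (C * (Real.sqrt (d : ℝ) / (n : ℝ)) *
              min ((d : ℝ) / min (b : ℝ) (d : ℝ)) (Real.sqrt (m : ℝ)) ≤ ρ ^ 2 →
          ∃ P : DistributedTesting.PrivateCoinProtocol m d b,
            P.risk n ρ ≤ ENNReal.ofReal α) := by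
  obtain ⟨C₁, hC₁, h₁⟩ := DistributedTesting.exists_public_protocol hα0
  obtain ⟨C₂, hC₂, h₂⟩ := DistributedTesting.exists_private_protocol hα0
  refine ⟨C₁ + C₂, by positivity, fun n m d b hn hm hd hb ρ hρ => ⟨fun h => ?_, fun h => ?_⟩⟩
  · refine h₁ n m d b hn hm hd hb ρ hρ (le_trans ?_ h)
    gcongr
    linarith
  · refine h₂ n m d b hn hm hd hb ρ hρ (le_trans ?_ h)
    gcongr
    linarith
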